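/- Let $I\subset\mathbb R$ be an interval with at least two points. A function $D:I^2\to\mathbb R$ is called a deviation if for every $x\in I$ the function $I\ni t\mapsto D(x,t)$ is strictly decreasing and continuous, and $D(t,t)=0$ for all $t\in I$. For $n\ge 1$ and $x_1,\dots,x_n\in I$, the deviation mean $\mathscr M_n^D(x_1,\dots,x_n)$ is the unique solution $t\in I$ of $\sum_{i=1}^n D(x_i,t)=0$. Let $D:I^2\to\mathbb R$ be a deviation and let $(\xi_n)_{n\ge1}$ be a sequence of independent and identically distributed real random variables on a probability space $(\Omega,\mathcal F,\mathbb P)$. Put $I^D_{\xi_1}:=\{t\in I:\mathbb E|D(\xi_1,t)|<\infty\}$. Assume the following. (i) For every $t\in I$ the function $I\ni x\mapsto D(x,t)$ is Borel measurable. (ii) $\mathbb P(\xi_1\in I)=1$, and there is a (necessarily unique) $t_0\in I^D_{\xi_1}$ with $\mathbb E\,D(\xi_1,t_0)=0$; moreover $t_0$ is an interior point of $I^D_{\xi_1}$. (iii') For every $x\in I$ the function $t\mapsto D(x,t)$ is differentiable at $t_0$, with derivative denoted by $\partial_2D(x,t_0)$, and there exist $r>0$ with $(t_0-r,t_0+r)\subset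 I^D_{\xi_1}$, $\alpha\in[0,\infty)$, a nonnegative Borel measurable function $H:I\to\mathbb R$ and a nonnegative function $h:(0,r)\to\mathbb R$ such that $$\left|\frac{D(x,t)-D(x,t_0)}{t-t_0}-\partial_2D(x,t_0)\right|\le H(x)\,h(|t-t_0|)$$ for all $x\in I$ and all $t\in(t_0-r,t_0+r)$ with $t\ne t_0$; moreover $\limsup_{s\to0^+}h(s)/s^\alpha$ is $0$ if $\alpha=0$ and is finite if $\alpha>0$; and $\mathbb E(H(\xi_1)^q)<\infty$, where $q=1$ if $\alpha=0$, and $q$ is some number in $\left(\frac{2}{2+\alpha},1\right)$ if $\alpha>0$. (iv) $0<\mathbb E(D(\xi_1,t_0)^2)<\infty$ and $0<\mathbb E(-\partial_2D(\xi_1,t_0))<\infty$. Then, almost surely, $$\limsup_{n\to\infty}\frac{\mathscr M_n^D(\xi_1,\dots,\xi_n)-t_0}{\sqrt{2n^{-1}\ln(\ln n)}}=\frac{\sqrt{\mathbb E(D(\xi_1,t_0)^2)}}{\mathbb E(-\partial_2D(\xi_1,t_0))}$$ and $$\liminf_{n\to\infty}\frac{\mathscr M_n^D(\xi_1,\dots,\xi_n)-t_0}{\sqrt{2n^{-1}\ln(\ln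 n)}}=-\frac{\sqrt{\mathbb E(D(\xi_1,t_0)^2)}}{\mathbb E(-\partial_2D(\xi_1,t_0))}.$$ -/

import Mathlib

open MeasureTheory ProbabilityTheory Filter Set
open scoped Topology

/-- `D` is a deviation on the interval `I`. A function `I × I → ℝ` is represented by a function
`ℝ → ℝ → ℝ` of which only the values on `I × I` are ever used. -/
structure IsDeviation (I : Set ℝ) (D : ℝ → ℝ → ℝ) : Prop where
  strictAntiOn : ∀ x ∈ I, StrictAntiOn (fun t => D x t) I
  continuousOn : ∀ x ∈ I, ContinuousOn (fun t => D x t) I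
  self_eq_zero : ∀ t ∈ I, D t t = 0

/-- For all `t ∈ I`, the function `I → ℝ`, `x ↦ D x t`, is Borel measurable. -/
def IsBorelMeasurableFst (I : Set ℝ) (D : ℝ → ℝ → ℝ) : Prop :=
  ∀ t ∈ I, Measurable (fun x : I => D (x : ℝ) t)

/-- Well-definedness of the deviation mean: the equation `∑ i, D (x i) t = 0` has exactly one
solution `t` in `I`. -/
theorem IsDeviation.existsUnique {I : Set ℝ} {D : ℝ → ℝ → ℝ} (hI : I.OrdConnected)
    (hD : IsDeviation I D) {n : ℕ} (hn : 0 < n) (x : Fin n → ℝ) (hx : ∀ i, x i ∈ I) :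
    ∃! t, t ∈ I ∧ ∑ i, D (x i) t = 0 := by
  have : Nonempty (Fin n) := ⟨⟨0, hn⟩⟩
  obtain ⟨a, -, ha⟩ := Finset.exists_min_image Finset.univ x Finset.univ_nonempty
  obtain ⟨b, -, hb⟩ := Finset.exists_max_image Finset.univ x Finset.univ_nonempty
  have hsub : Icc (x a) (x b) ⊆ I := hI.out (hx a) (hx b)
  have hcont : ContinuousOn (fun t => ∑ i, D (x i) t) (Icc (x a) (x b)) :=
    continuousOn_finsetSum _ fun i _ => (hD.continuousOn (x i) (hx i)).mono hsub
  have h1 : 0 ≤ ∑ i, D (x i) (x a) := Finset.sum_nonneg fun i hi => by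
    rw [← hD.self_eq_zero (x i) (hx i)]
    exact (hD.strictAntiOn (x i) (hx i)).antitoneOn (hx a) (hx i) (ha i hi)
  have h2 : ∑ i, D (x i) (x b) ≤ 0 := Finset.sum_nonpos fun i hi => by
    rw [← hD.self_eq_zero (x i) (hx i)]
    exact (hD.strictAntiOn (x i) (hx i)).antitoneOn (hx i) (hx b) (hb i hi)
  obtain ⟨t, ht, ht0⟩ := intermediate_value_Icc' (ha b (Finset.mem_univ _)) hcont ⟨h2, h1⟩
  have hanti : StrictAntiOn (fun t => ∑ i, D (x i) t) I := fun s hs u hu hsu =>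
    Finset.sum_lt_sum_of_nonempty Finset.univ_nonempty
      fun i _ => hD.strictAntiOn (x i) (hx i) hs hu hsu
  refine ⟨t, ⟨hsub ht, ht0⟩, fun u hu => hanti.injOn hu.1 (hsub ht) ?_⟩
  exact hu.2.trans ht0.symm

open Classical in
/-- The `n`-variable deviation mean of `x₁, …, xₙ ∈ I`: the unique solution `t ∈ I` of
`∑ i, D (x i) t = 0` (and `0` if there is no solution, which does not happen
for a deviation `D`, `n ≥ 1` and `x i ∈ I`). -/
noncomputable def deviationMean (I : Set ℝ) (D : ℝ → ℝ → ℝ) (n : ℕ) (x : Fin n → ℝ) : ℝ :=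
  if h : ∃ t, t ∈ I ∧ ∑ i, D (x i) t = 0 then h.choose else 0

/-- The set of those `t ∈ I` for which `D(ξ, t)` has a finite expectation. -/
def integrabilityDomain {Ω : Type*} [MeasurableSpace Ω] (P : Measure Ω) (I : Set ℝ)
    (D : ℝ → ℝ → ℝ) (ξ : Ω → ℝ) : Set ℝ :=
  {t | t ∈ I ∧ Integrable (fun ω => D (ξ ω) t) P}

/-- `t₀` is the `D`-deviation mean of the random variable `ξ`. -/
def IsDeviationMeanOf {Ω : Type*} [MeasurableSpace Ω] (P : Measure Ω) (I : Set ℝ)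
    (D : ℝ → ℝ → ℝ) (ξ : Ω → ℝ) (t₀ : ℝ) : Prop :=
  t₀ ∈ integrabilityDomain P I D ξ ∧ ∫ ω, D (ξ ω) t₀ ∂P = 0

/-- The partial derivative of `D : I × I → ℝ` with respect to its second variable. -/
noncomputable def partialSnd (I : Set ℝ) (D : ℝ → ℝ → ℝ) (x t : ℝ) : ℝ :=
  derivWithin (fun s => D x s) I t

/-- The condition on the remainder of the first-order expansion of `D` in the second variable
at `t₀`. The upper limits are taken in the extended real line. -/
def RemainderCondition {Ω : Type*} [MeasurableSpace Ω] (P : Measure Ω) (I : Set ℝ)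
    (D : ℝ → ℝ → ℝ) (ξ : Ω → ℝ) (t₀ : ℝ) : Prop :=
  (∀ x ∈ I, DifferentiableWithinAt ℝ (fun s => D x s) I t₀) ∧
  ∃ (r α q : ℝ) (H h : ℝ → ℝ),
    0 < r ∧ 0 ≤ α ∧
    ((α = 0 ∧ q = 1) ∨ (0 < α ∧ q ∈ Ioo (2 / (2 + α)) 1)) ∧
    (∀ x ∈ I, 0 ≤ H x) ∧ Measurable (fun x : I => H (x : ℝ)) ∧
    (∀ s ∈ Ioo 0 r, 0 ≤ h s) ∧
    Ioo (t₀ - r) (t₀ + r) ⊆ integrabilityDomain P I D ξ ∧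
    (∀ x ∈ I, ∀ t ∈ Ioo (t₀ - r) (t₀ + r), t ≠ t₀ →
      |(D x t - D x t₀) / (t - t₀) - partialSnd I D x t₀| ≤ H x * h |t - t₀|) ∧
    (α = 0 → limsup (fun s : ℝ => ((h s / s ^ α : ℝ) : EReal)) (𝓝[>] 0) = 0) ∧
    (0 < α → limsup (fun s : ℝ => ((h s / s ^ α : ℝ) : EReal)) (𝓝[>] 0) < ⊤) ∧
    Integrable (fun ω => H (ξ ω) ^ q) P

/-! Since `∑ i, D (ξ i) t` is strictly decreasing in `t`, the sign of this sum at `t` tells on which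
side of `t` the deviation mean lies. Take `t = t₀ + c * lilRate n` and divide the sum by `n *
lilRate n`. The first-order expansion at `t₀` gives `S n / (n * lilRate n) - c * m + o(1)`, where `S
n = ∑ D (ξ i) t₀` and `m = 𝔼(-∂₂D)`: the strong law handles the derivatives, and the remainder is at
most a constant times `h (|c| * lilRate n)` times the average of `H`. Hence the normalised mean is
compared with `c` as `S n / (n * lilRate n)` is with `c * m`, and the Hartman-Wintner law for `S n`
transfers after division by `m` (`IsDeviation.exists_comparison`, `EReal.limsup_eq_of_comparison`).
The lower limit comes from the same law for `-D`.

For `α > 0` only a moment of order `q < 1` of `H` is available, so the average of `H` may grow like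
`n ^ (1/q - 1)`; the condition `q > 2 / (2 + α)` is what lets `lilRate n ^ α` beat this growth
(`tendsto_modulus_mul_average`).

The Hartman-Wintner law is proved here for variance one and then rescaled. Upper half: truncate at a
small multiple of `√(n / log log n)`; the discarded part is negligible by Kronecker's lemma, and
Doob's inequality for the exponential submartingale gives tail bounds summable along a geometric
sequence. Lower half: cut the increment between `k !` and `(k + 1)!` into about `2 log log / s²`
equal blocks. The central limit theorem bounds below the probability that one block is large,
independence multiplies these bounds, and the product is at least `K / (k + 1)`. The second
Borel-Cantelli lemma applies, and the sum up to `k !` is negligible by the upper half. -/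

/-! ### Regularised scales, their monotonicity, and Kronecker's lemma. -/

/-- A regularised version of `log (log n)`, at least `1` everywhere. -/
noncomputable def iterLog (n : ℕ) : ℝ := 1 + Real.log (Real.log n + 2)

/-- The scale `√(2 n log log n)` of the law of the iterated logarithm, with the regularised
iterated logarithm. -/
noncomputable def lilScale (n : ℕ) : ℝ := √(2 * n * iterLog n)

theorem one_le_iterLog (n : ℕ) : 1 ≤ iterLog n := by
  have h : 0 ≤ Real.log n := Real.log_natCast_nonneg n
  have := Real.log_nonneg (show (1 : ℝ) ≤ Real.log n + 2 by linarith)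
  unfold iterLog; linarith

theorem iterLog_pos (n : ℕ) : 0 < iterLog n := one_pos.trans_le (one_le_iterLog n)

theorem iterLog_mono {m n : ℕ} (h : m ≤ n) : iterLog m ≤ iterLog n := by
  have h0 : 0 ≤ Real.log m := Real.log_natCast_nonneg m
  have h1 : Real.log m ≤ Real.log n := by
    rcases Nat.eq_zero_or_pos m with rfl | hm
    · simpa using Real.log_natCast_nonneg n
    · exact Real.log_le_log (by exact_mod_cast hm) (by exact_mod_cast h)
  have := Real.log_le_log (show 0 < Real.log m + 2 by linarith) (add_le_add_left h1 2)
  unfold iterLog; linarith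

/-- Quantitative slow variation. The shift by `2` inside `iterLog` bounds the increment by half of
`log (n / m)`, hence by `√(n / m) - 1`; the bound `1 ≤ iterLog m` makes this multiplicative. -/
theorem iterLog_le_mul_sqrt {m n : ℕ} (hm : 0 < m) (h : m ≤ n) :
    iterLog n ≤ iterLog m * √(n / m) := by
  have hm' : (0 : ℝ) < m := by exact_mod_cast hm
  have hn' : (0 : ℝ) < n := by exact_mod_cast hm.trans_le h
  have h0 : 0 ≤ Real.log m := Real.log_natCast_nonneg m
  have h0n : 0 ≤ Real.log n := Real.log_natCast_nonneg n
  have hr : 0 < (n : ℝ) / m := by positivity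
  have h1 : 1 ≤ (n : ℝ) / m := by rw [one_le_div hm']; exact_mod_cast h
  have hs : 1 ≤ √((n : ℝ) / m) := Real.one_le_sqrt.2 h1
  have e1 : Real.log n - Real.log m = 2 * Real.log (√((n : ℝ) / m)) := by
    rw [Real.log_sqrt hr.le, Real.log_div hn'.ne' hm'.ne']; ring
  have e2 : Real.log (√((n : ℝ) / m)) ≤ √((n : ℝ) / m) - 1 :=
    Real.log_le_sub_one_of_pos (by positivity)
  have e3 : Real.log (Real.log n + 2) - Real.log (Real.log m + 2) ≤
      (Real.log n - Real.log m) / 2 := by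
    rw [← Real.log_div (by positivity) (by positivity)]
    refine (Real.log_le_sub_one_of_pos (by positivity)).trans ?_
    have : (Real.log n + 2) / (Real.log m + 2) - 1 =
        (Real.log n - Real.log m) / (Real.log m + 2) := by field_simp; ring
    rw [this]
    apply div_le_div_of_nonneg_left _ (by norm_num) (by linarith)
    linarith [Real.log_nonneg hs]
  have e4 := one_le_iterLog m
  have : iterLog n ≤ iterLog m + (√((n : ℝ) / m) - 1) := by
    unfold iterLog; linarith
  nlinarith

theorem lilScale_nonneg (n : ℕ) : 0 ≤ lilScale n := Real.sqrt_nonneg _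

theorem lilScale_pos {n : ℕ} (hn : 0 < n) : 0 < lilScale n := by
  have := iterLog_pos n
  have : (0 : ℝ) < n := by exact_mod_cast hn
  unfold lilScale; positivity

theorem lilScale_mono {m n : ℕ} (h : m ≤ n) : lilScale m ≤ lilScale n := by
  have h1 := iterLog_mono h
  have h2 : (m : ℝ) ≤ n := by exact_mod_cast h
  have := iterLog_pos m
  unfold lilScale; gcongr

theorem sqrt_le_lilScale (n : ℕ) : √n ≤ lilScale n := by
  have := one_le_iterLog n
  have h : (0 : ℝ) ≤ n := n.cast_nonneg
  apply Real.sqrt_le_sqrt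
  nlinarith

theorem tendsto_lilScale_atTop : Tendsto lilScale atTop atTop :=
  tendsto_atTop_mono sqrt_le_lilScale
    (Real.tendsto_sqrt_atTop.comp tendsto_natCast_atTop_atTop)

theorem lilScale_sq (n : ℕ) : lilScale n ^ 2 = 2 * n * iterLog n := by
  have := iterLog_pos n
  exact Real.sq_sqrt (by positivity)

/-- The truncation level used in the proof of the law of the iterated logarithm. -/
noncomputable def truncLevel (n : ℕ) : ℝ := √(n / iterLog n)

theorem sqrt_div_iterLog_mono {m n : ℕ} (hm : 0 < m) (h : m ≤ n) :
    √(√m) / √(iterLog m) ≤ √(√n) / √(iterLog n) := by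
  have hm' : (0 : ℝ) < m := by exact_mod_cast hm
  have := iterLog_pos m
  have := iterLog_pos n
  rw [← Real.sqrt_div (by positivity), ← Real.sqrt_div (by positivity)]
  apply Real.sqrt_le_sqrt
  rw [div_le_div_iff₀ (by positivity) (by positivity)]
  have := iterLog_le_mul_sqrt hm h
  rw [Real.sqrt_div (by positivity), mul_div_assoc', le_div_iff₀ (by positivity)] at this
  linarith

theorem truncLevel_eq (n : ℕ) : truncLevel n = √(√n) * (√(√n) / √(iterLog n)) := by
  rw [truncLevel, Real.sqrt_div (by positivity), mul_div_assoc', Real.mul_self_sqrt (by positivity)]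

theorem truncLevel_nonneg (n : ℕ) : 0 ≤ truncLevel n := Real.sqrt_nonneg _

theorem truncLevel_mono {m n : ℕ} (hm : 0 < m) (h : m ≤ n) : truncLevel m ≤ truncLevel n := by
  rw [truncLevel_eq, truncLevel_eq]
  have := sqrt_div_iterLog_mono hm h
  have h2 : (m : ℝ) ≤ n := by exact_mod_cast h
  gcongr

/-- Telescoping: consecutive fourth roots `v ≤ u` satisfy `1 = u⁴ - v⁴ ≤ 4 u³ (u - v)`. -/
theorem sum_inv_root_le (N : ℕ) :
    ∑ i ∈ Finset.range N, (√(√((i + 1 : ℕ) : ℝ)) ^ 3)⁻¹ ≤ 4 * √(√(N : ℝ)) := by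
  induction N with
  | zero => simp
  | succ N ih =>
    rw [Finset.sum_range_succ]
    set v := √(√(N : ℝ)) with hv
    set u := √(√((N + 1 : ℕ) : ℝ)) with hu
    have hv0 : 0 ≤ v := Real.sqrt_nonneg _
    have hu0 : 0 < u := by positivity
    have hv4 : v ^ 4 = N := by
      rw [show v ^ 4 = (v ^ 2) ^ 2 by ring, Real.sq_sqrt (by positivity),
        Real.sq_sqrt (by positivity)]
    have hu4 : u ^ 4 = N + 1 := by
      rw [show u ^ 4 = (u ^ 2) ^ 2 by ring, Real.sq_sqrt (by positivity),
        Real.sq_sqrt (by positivity)]; simp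
    have hvu : v ≤ u := by
      apply Real.sqrt_le_sqrt; apply Real.sqrt_le_sqrt; simp
    have key : (u ^ 3)⁻¹ ≤ 4 * u - 4 * v := by
      rw [inv_le_iff_one_le_mul₀ (by positivity)]
      have h1 : v ^ 3 ≤ u ^ 3 := by gcongr
      have h2 : v ^ 2 ≤ u ^ 2 := by gcongr
      have h3 : u ^ 4 - v ^ 4 = 1 := by linarith
      have h4 : u ^ 4 - v ^ 4 = (u - v) * (u ^ 3 + u ^ 2 * v + u * v ^ 2 + v ^ 3) := by ring
      have h5 : u ^ 3 + u ^ 2 * v + u * v ^ 2 + v ^ 3 ≤ 4 * u ^ 3 := by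
        nlinarith [mul_le_mul_of_nonneg_left hvu (sq_nonneg u), mul_le_mul_of_nonneg_left h2 hu0.le]
      nlinarith [mul_le_mul_of_nonneg_left h5 (sub_nonneg.2 hvu)]
    linarith

/-- Each term is at most `i ^ (-3/4)` times `i ^ (1/4) / √(iterLog i)`. The second factor is
monotone, so its value at `n` can be pulled out of the sum. This bound is what makes a second moment
suffice for the truncation. -/
theorem sum_inv_lilScale_le (n : ℕ) :
    ∑ i ∈ Finset.range n, (lilScale (i + 1))⁻¹ ≤ 4 * truncLevel n := by
  have hb : ∀ i ∈ Finset.range n, (lilScale (i + 1))⁻¹ ≤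
      (√(√n) / √(iterLog n)) * (√(√((i + 1 : ℕ) : ℝ)) ^ 3)⁻¹ := by
    intro i hi
    have hi' : i + 1 ≤ n := Finset.mem_range.1 hi
    refine le_trans ?_ (mul_le_mul_of_nonneg_right (sqrt_div_iterLog_mono i.succ_pos hi')
      (by positivity))
    have hL := iterLog_pos (i + 1)
    set w := √(√((i + 1 : ℕ) : ℝ)) with hw
    have hw0 : 0 < w := by positivity
    have hw2 : w ^ 2 = √((i + 1 : ℕ) : ℝ) := Real.sq_sqrt (by positivity)
    have e : w / √(iterLog (i + 1)) * (w ^ 3)⁻¹ = (w ^ 2 * √(iterLog (i + 1)))⁻¹ := by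
      field_simp
    rw [e, hw2, ← Real.sqrt_mul (by positivity)]
    gcongr
    apply Real.sqrt_le_sqrt
    have : (0 : ℝ) ≤ ((i + 1 : ℕ) : ℝ) * iterLog (i + 1) := by positivity
    linarith
  refine (Finset.sum_le_sum hb).trans ?_
  rw [← Finset.mul_sum, truncLevel_eq]
  have := mul_le_mul_of_nonneg_left (sum_inv_root_le n)
    (show 0 ≤ √(√n) / √(iterLog n) by positivity)
  linarith

/-- A form of Kronecker's lemma for nonnegative series. -/
theorem tendsto_sum_div_of_summable {a c : ℕ → ℝ} (ha : ∀ n, 0 < n → 0 < a n)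
    (hmono : ∀ m n, m ≤ n → a m ≤ a n) (hlim : Tendsto a atTop atTop) (hc : ∀ i, 0 ≤ c i)
    (hs : Summable fun i => c i / a (i + 1)) :
    Tendsto (fun n => (∑ i ∈ Finset.range n, c i) / a n) atTop (𝓝 0) := by
  -- Write the quotient as a series over all `i`: each term tends to zero and is dominated by the
  -- summable `c i / a (i + 1)`.
  have h := tendsto_tsum_of_dominated_convergence (𝓕 := atTop)
    (f := fun n i => if i < n then c i / a n else 0) (g := fun _ => (0 : ℝ)) hs ?_ ?_
  · simp only [tsum_zero] at h
    refine h.congr fun n => ?_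
    rw [tsum_eq_sum (s := Finset.range n), Finset.sum_div]
    · exact Finset.sum_congr rfl fun i hi => if_pos (Finset.mem_range.1 hi)
    · intro i hi
      exact if_neg (by simpa using hi)
  · intro i
    have : Tendsto (fun n => c i / a n) atTop (𝓝 0) := hlim.const_div_atTop (c i)
    refine this.congr' ?_
    filter_upwards [eventually_gt_atTop i] with n hn
    simp [hn]
  · refine Eventually.of_forall fun n i => ?_
    split_ifs with hi
    · have h1 := ha (i + 1) i.succ_pos
      have h2 := hmono (i + 1) n hi
      rw [Real.norm_eq_abs, abs_of_nonneg (div_nonneg (hc i) (h1.le.trans h2))]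
      exact div_le_div_of_nonneg_left (hc i) h1 h2
    · simpa using div_nonneg (hc i) (ha (i + 1) i.succ_pos).le

theorem tendsto_log_natCast_atTop : Tendsto (fun n : ℕ => Real.log n) atTop atTop :=
  Real.tendsto_log_atTop.comp tendsto_natCast_atTop_atTop

theorem tendsto_iterLog_div_log_log :
    Tendsto (fun n : ℕ => iterLog n / Real.log (Real.log n)) atTop (𝓝 1) := by
  have h1 : Tendsto (fun n : ℕ => Real.log (Real.log n)) atTop atTop :=
    Real.tendsto_log_atTop.comp tendsto_log_natCast_atTop
  have h2 : Tendsto (fun n : ℕ => (1 + Real.log 2 + 1) / Real.log (Real.log n)) atTop (𝓝 0) :=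
    h1.const_div_atTop _
  have h3 := h2.const_add 1
  rw [add_zero] at h3
  refine tendsto_of_tendsto_of_tendsto_of_le_of_le' tendsto_const_nhds h3 ?_ ?_
  · filter_upwards [h1.eventually_gt_atTop 0, tendsto_log_natCast_atTop.eventually_gt_atTop 2]
      with n hn hn2
    rw [one_le_div hn]
    have := Real.log_le_log (by linarith : 0 < Real.log n) (by linarith : Real.log n ≤ Real.log n + 2)
    unfold iterLog; linarith
  · filter_upwards [h1.eventually_gt_atTop 0, tendsto_log_natCast_atTop.eventually_gt_atTop 2]
      with n hn hn2
    rw [div_le_iff₀ hn, add_mul, div_mul_cancel₀ _ hn.ne']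
    have := Real.log_le_log (by linarith : 0 < Real.log n + 2)
      (by linarith : Real.log n + 2 ≤ 2 * Real.log n)
    rw [Real.log_mul (by norm_num) (by linarith)] at this
    unfold iterLog; linarith

theorem tendsto_iterLog_div_natCast : Tendsto (fun n : ℕ => iterLog n / n) atTop (𝓝 0) := by
  have h : Tendsto (fun n : ℕ => iterLog 1 / √(n : ℝ)) atTop (𝓝 0) :=
    (Real.tendsto_sqrt_atTop.comp tendsto_natCast_atTop_atTop).const_div_atTop _
  refine squeeze_zero' (Eventually.of_forall fun n => ?_) ?_ h
  · have := iterLog_pos n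
    positivity
  · filter_upwards [eventually_gt_atTop 0] with n hn
    have hn' : (0 : ℝ) < n := by exact_mod_cast hn
    rw [div_le_div_iff₀ hn' (by positivity)]
    have := iterLog_le_mul_sqrt one_pos (Nat.one_le_iff_ne_zero.2 hn.ne')
    simp only [Nat.cast_one, div_one] at this
    have h2 := mul_le_mul_of_nonneg_right this (Real.sqrt_nonneg (n : ℝ))
    rwa [mul_assoc, Real.mul_self_sqrt hn'.le] at h2

/-! ### An exponential maximal inequality for bounded independent summands. -/

theorem exp_le_quadratic {x : ℝ} (hx : |x| ≤ 1) :
    Real.exp x ≤ 1 + x + x ^ 2 / 2 * (1 + |x|) := by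
  have h := Real.exp_bound hx (n := 3) (by norm_num)
  have h' := (abs_le.1 h).2
  simp [Finset.sum_range_succ, Nat.factorial] at h'
  have h3 : |x| ^ 3 = x ^ 2 * |x| := by rw [← sq_abs x]; ring
  rw [h3] at h'
  nlinarith [mul_nonneg (sq_nonneg x) (abs_nonneg x)]

section Exponential

variable {Ω : Type*} [MeasurableSpace Ω] {P : Measure Ω} [IsProbabilityMeasure P]

theorem integrable_of_abs_le {Z : Ω → ℝ} {B : ℝ} (hZ : Measurable Z) (hB : ∀ ω, |Z ω| ≤ B) :
    Integrable Z P :=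
  Integrable.of_bound hZ.aestronglyMeasurable B (Eventually.of_forall hB)

theorem integrable_exp_of_abs_le {Z : Ω → ℝ} {B l : ℝ} (hZ : Measurable Z)
    (hB : ∀ ω, |Z ω| ≤ B) (hl : 0 ≤ l) : Integrable (fun ω => Real.exp (l * Z ω)) P := by
  refine Integrable.of_bound (by fun_prop) (Real.exp (l * B)) (Eventually.of_forall fun ω => ?_)
  rw [Real.norm_eq_abs, Real.abs_exp]
  exact Real.exp_le_exp.2 (mul_le_mul_of_nonneg_left ((le_abs_self _).trans (hB ω)) hl)

theorem mgf_le_of_abs_le {Z : Ω → ℝ} {B l : ℝ} (hZ : Measurable Z) (hB : ∀ ω, |Z ω| ≤ B)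
    (hmean : ∫ ω, Z ω ∂P = 0) (hsq : ∫ ω, Z ω ^ 2 ∂P ≤ 1) (hl : 0 ≤ l) (hlB : l * B ≤ 1) :
    mgf Z P l ≤ Real.exp (l ^ 2 / 2 * (1 + l * B)) := by
  have hint := integrable_of_abs_le (P := P) hZ hB
  have hint2 : Integrable (fun ω => Z ω ^ 2) P := by
    refine integrable_of_abs_le (B := B ^ 2) (by fun_prop) fun ω => ?_
    rw [abs_pow]
    exact pow_le_pow_left₀ (abs_nonneg _) (hB ω) 2
  have hB0 : 0 ≤ B := by
    obtain ⟨ω⟩ : Nonempty Ω := nonempty_of_isProbabilityMeasure P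
    exact (abs_nonneg _).trans (hB ω)
  have hpt : ∀ ω, Real.exp (l * Z ω) ≤ 1 + l * Z ω + l ^ 2 / 2 * (1 + l * B) * Z ω ^ 2 := by
    intro ω
    have h1 : |l * Z ω| ≤ l * B := by
      rw [abs_mul, abs_of_nonneg hl]; exact mul_le_mul_of_nonneg_left (hB ω) hl
    refine (exp_le_quadratic (h1.trans hlB)).trans ?_
    have : (l * Z ω) ^ 2 / 2 * (1 + |l * Z ω|) ≤ (l * Z ω) ^ 2 / 2 * (1 + l * B) := by gcongr
    linarith [mul_pow l (Z ω) 2]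
  have h1 : mgf Z P l ≤ ∫ ω, (1 + l * Z ω + l ^ 2 / 2 * (1 + l * B) * Z ω ^ 2) ∂P :=
    integral_mono (integrable_exp_of_abs_le hZ hB hl)
      (((integrable_const _).add (hint.const_mul _)).add (hint2.const_mul _)) hpt
  rw [integral_add (by fun_prop) (by fun_prop), integral_add (by fun_prop) (by fun_prop),
    integral_const_mul, integral_const_mul, hmean] at h1
  simp only [integral_const, probReal_univ, smul_eq_mul, mul_one, mul_zero, add_zero] at h1
  have hc : 0 ≤ l ^ 2 / 2 * (1 + l * B) := by positivity
  have := mul_le_mul_of_nonneg_left hsq hc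
  linarith [Real.add_one_le_exp (l ^ 2 / 2 * (1 + l * B))]

/-- The new factor is independent of the past and has expectation at least `1`, because `exp y ≥ 1 +
y` and the summands are centred. -/
theorem submartingale_exp_sum {Z : ℕ → Ω → ℝ} {B : ℕ → ℝ} {l : ℝ} (hZ : ∀ i, Measurable (Z i))
    (hindep : iIndepFun Z P) (hB : ∀ i ω, |Z i ω| ≤ B i) (hmean : ∀ i, ∫ ω, Z i ω ∂P = 0)
    (hl : 0 ≤ l) :
    Submartingale (fun k ω => Real.exp (l * ∑ i ∈ Finset.range (k + 1), Z i ω))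
      (Filtration.natural Z fun i => (hZ i).stronglyMeasurable) P := by
  have hBsum : ∀ n ω, |∑ i ∈ Finset.range n, Z i ω| ≤ ∑ i ∈ Finset.range n, B i := fun n ω =>
    (Finset.abs_sum_le_sum_abs _ _).trans (Finset.sum_le_sum fun i _ => hB i ω)
  have hadp : StronglyAdapted (Filtration.natural Z fun i => (hZ i).stronglyMeasurable)
      (fun k ω => Real.exp (l * ∑ i ∈ Finset.range (k + 1), Z i ω)) := by
    intro k
    refine Real.continuous_exp.comp_stronglyMeasurable (StronglyMeasurable.const_mul ?_ l)
    refine Finset.stronglyMeasurable_fun_sum _ fun i hi => ?_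
    exact ((Filtration.stronglyAdapted_natural fun i => (hZ i).stronglyMeasurable) i).mono
      ((Filtration.natural Z fun i => (hZ i).stronglyMeasurable).mono
        (Nat.lt_succ_iff.1 (Finset.mem_range.1 hi)))
  have hint : ∀ k, Integrable (fun ω => Real.exp (l * ∑ i ∈ Finset.range (k + 1), Z i ω)) P :=
    fun k => integrable_exp_of_abs_le (Finset.measurable_fun_sum _ fun i _ => hZ i)
      (hBsum (k + 1)) hl
  refine submartingale_nat hadp hint fun k => ?_
  have hexp := integrable_exp_of_abs_le (P := P) (hZ (k + 1)) (hB (k + 1)) hl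
  have hsplit : (fun ω => Real.exp (l * ∑ i ∈ Finset.range (k + 1 + 1), Z i ω)) =
      (fun ω => Real.exp (l * ∑ i ∈ Finset.range (k + 1), Z i ω)) *
        fun ω => Real.exp (l * Z (k + 1) ω) := by
    ext ω
    rw [Finset.sum_range_succ, mul_add, Real.exp_add]; rfl
  have hpull := condExp_mul_of_stronglyMeasurable_left (μ := P) (hadp k)
    (hsplit ▸ hint (k + 1)) hexp
  have hcond := condExp_indep_eq (μ := P) (hZ (k + 1)).comap_le
    ((Filtration.natural Z fun i => (hZ i).stronglyMeasurable).le k)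
    (f := fun ω => Real.exp (l * Z (k + 1) ω))
    (Real.continuous_exp.comp_stronglyMeasurable
      (StronglyMeasurable.const_mul (comap_measurable (Z (k + 1))).stronglyMeasurable l))
    (hindep.indep_comap_natural_of_lt _ k.lt_succ_self)
  have hge : 1 ≤ ∫ ω, Real.exp (l * Z (k + 1) ω) ∂P := by
    have hi := integrable_of_abs_le (P := P) (hZ (k + 1)) (hB (k + 1))
    have h1 : ∫ ω, (l * Z (k + 1) ω + 1) ∂P ≤ ∫ ω, Real.exp (l * Z (k + 1) ω) ∂P :=
      integral_mono ((hi.const_mul l).add (integrable_const _)) hexp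
        fun ω => Real.add_one_le_exp _
    rw [integral_add (hi.const_mul l) (integrable_const _), integral_const_mul, hmean] at h1
    simpa using h1
  rw [hsplit]
  filter_upwards [hpull, hcond] with ω h1 h2
  rw [h1, Pi.mul_apply, h2]
  exact le_mul_of_one_le_right (Real.exp_nonneg _) hge

theorem measure_max_sum_ge_le {Z : ℕ → Ω → ℝ} {B l x : ℝ} {N : ℕ} {b : ℕ → ℝ}
    (hZ : ∀ i, Measurable (Z i))
    (hindep : iIndepFun Z P) (hb : ∀ i ω, |Z i ω| ≤ b i) (hB : ∀ i < N, b i ≤ B)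
    (hmean : ∀ i, ∫ ω, Z i ω ∂P = 0) (hsq : ∀ i, ∫ ω, Z i ω ^ 2 ∂P ≤ 1) (hl : 0 ≤ l)
    (hlB : l * B ≤ 1) :
    P {ω | ∃ n, 0 < n ∧ n ≤ N ∧ x ≤ ∑ i ∈ Finset.range n, Z i ω} ≤
      ENNReal.ofReal (Real.exp (-(l * x) + N * (l ^ 2 / 2 * (1 + l * B)))) := by
  -- Time `k` of the submartingale carries `k + 1` summands, so `N = 0`, where the event is empty,
  -- is treated apart.
  rcases N with _ | N
  · have : {ω | ∃ n, 0 < n ∧ n ≤ 0 ∧ x ≤ ∑ i ∈ Finset.range n, Z i ω} = ∅ := by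
      ext ω; simp only [mem_ofPred_eq, mem_empty_iff_false, iff_false]; rintro ⟨n, h1, h2, -⟩; omega
    rw [this]; simp
  have hsub := submartingale_exp_sum hZ hindep hb hmean hl
  have hmax := maximal_ineq hsub (fun k ω => (Real.exp_pos _).le)
    (ε := (Real.exp (l * x)).toNNReal) N
  rw [Real.coe_toNNReal _ (Real.exp_pos _).le] at hmax
  set A := {ω | Real.exp (l * x) ≤ (Finset.range (N + 1)).sup' Finset.nonempty_range_add_one
    fun k => Real.exp (l * ∑ i ∈ Finset.range (k + 1), Z i ω)} with hA
  have hsubset : {ω | ∃ n, 0 < n ∧ n ≤ N + 1 ∧ x ≤ ∑ i ∈ Finset.range n, Z i ω} ⊆ A := by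
    rintro ω ⟨n, hn, hnN, hx⟩
    obtain ⟨k, rfl⟩ : ∃ k, n = k + 1 := ⟨n - 1, by omega⟩
    refine le_trans (Real.exp_le_exp.2 (mul_le_mul_of_nonneg_left hx hl)) ?_
    exact Finset.le_sup' (fun k => Real.exp (l * ∑ i ∈ Finset.range (k + 1), Z i ω))
      (Finset.mem_range.2 (by omega))
  have hint : ∫ ω in A, Real.exp (l * ∑ i ∈ Finset.range (N + 1), Z i ω) ∂P ≤
      Real.exp ((N + 1 : ℕ) * (l ^ 2 / 2 * (1 + l * B))) := by
    refine (setIntegral_le_integral (hsub.integrable N)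
      (Eventually.of_forall fun ω => (Real.exp_pos _).le)).trans ?_
    have h1 := hindep.mgf_sum (t := l) hZ (Finset.range (N + 1))
    have h2 : mgf (∑ i ∈ Finset.range (N + 1), Z i) P l =
        ∫ ω, Real.exp (l * ∑ i ∈ Finset.range (N + 1), Z i ω) ∂P := by
      simp [mgf]
    rw [← h2, h1]
    refine (Finset.prod_le_prod (fun i _ => mgf_nonneg) fun i hi => mgf_le_of_abs_le (hZ i)
      (fun ω => (hb i ω).trans (hB i (Finset.mem_range.1 hi))) (hmean i) (hsq i) hl hlB).trans ?_
    rw [Finset.prod_const, Finset.card_range, ← Real.exp_nat_mul]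
  have h3 : ENNReal.ofReal (Real.exp (l * x)) * P A ≤
      ENNReal.ofReal (Real.exp ((N + 1 : ℕ) * (l ^ 2 / 2 * (1 + l * B)))) :=
    hmax.trans (ENNReal.ofReal_le_ofReal hint)
  calc P {ω | ∃ n, 0 < n ∧ n ≤ N + 1 ∧ x ≤ ∑ i ∈ Finset.range n, Z i ω} ≤ P A :=
        measure_mono hsubset
    _ = ENNReal.ofReal (Real.exp (-(l * x))) * (ENNReal.ofReal (Real.exp (l * x)) * P A) := by
        rw [← mul_assoc, ← ENNReal.ofReal_mul (Real.exp_pos _).le, ← Real.exp_add]; simp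
    _ ≤ ENNReal.ofReal (Real.exp (-(l * x))) *
        ENNReal.ofReal (Real.exp ((N + 1 : ℕ) * (l ^ 2 / 2 * (1 + l * B)))) := by gcongr
    _ = _ := by rw [← ENNReal.ofReal_mul (Real.exp_pos _).le, ← Real.exp_add]

end Exponential

/-! ### Truncation, and the tail bound for the truncated sums. -/

/-- Truncation of a real number at level `b`. -/
noncomputable def truncAt (b x : ℝ) : ℝ := if |x| ≤ b then x else 0

/-- The part of `|x|` that is cut off by the truncation at level `b`. -/
noncomputable def tailAt (b x : ℝ) : ℝ := if |x| ≤ b then 0 else |x|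

theorem measurable_truncAt (b : ℝ) : Measurable (truncAt b) :=
  Measurable.ite (measurableSet_le (by fun_prop) measurable_const) measurable_id measurable_const

theorem measurable_tailAt (b : ℝ) : Measurable (tailAt b) :=
  Measurable.ite (measurableSet_le (by fun_prop) measurable_const) measurable_const (by fun_prop)

theorem tailAt_nonneg (b x : ℝ) : 0 ≤ tailAt b x := by
  unfold tailAt; split_ifs <;> positivity

theorem tailAt_le (b x : ℝ) : tailAt b x ≤ |x| := by
  unfold tailAt; split_ifs
  · positivity
  · rfl

theorem abs_truncAt_le {b : ℝ} (hb : 0 ≤ b) (x : ℝ) : |truncAt b x| ≤ b := by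
  unfold truncAt; split_ifs with h
  · exact h
  · simpa

theorem abs_truncAt_le_abs (b x : ℝ) : |truncAt b x| ≤ |x| := by
  unfold truncAt; split_ifs <;> simp

theorem abs_sub_truncAt (b x : ℝ) : |x - truncAt b x| = tailAt b x := by
  unfold truncAt tailAt; split_ifs <;> simp

/-- Only the last index whose level lies below `|x|` matters: up to it the sum is at most `|x| * 4 *
truncLevel`, and there `truncLevel ≤ |x| / e`. Induction removes the vanishing terms beyond it. -/
theorem sum_tailAt_div_le {e : ℝ} (he : 0 < e) (x : ℝ) (n : ℕ) :
    ∑ i ∈ Finset.range n, tailAt (e * truncLevel (i + 1)) x / lilScale (i + 1) ≤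
      4 / e * x ^ 2 := by
  induction n with
  | zero => simp; positivity
  | succ n ih =>
    by_cases h : |x| ≤ e * truncLevel (n + 1)
    · rw [Finset.sum_range_succ, tailAt, if_pos h]
      simpa using ih
    · have h1 : ∑ i ∈ Finset.range (n + 1), tailAt (e * truncLevel (i + 1)) x / lilScale (i + 1) ≤
          ∑ i ∈ Finset.range (n + 1), |x| * (lilScale (i + 1))⁻¹ := by
        refine Finset.sum_le_sum fun i _ => ?_
        rw [div_eq_mul_inv]
        exact mul_le_mul_of_nonneg_right (tailAt_le _ _) (inv_nonneg.2 (lilScale_nonneg _))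
      refine h1.trans ?_
      rw [← Finset.mul_sum]
      have h2 := sum_inv_lilScale_le (n + 1)
      have h3 : truncLevel (n + 1) ≤ |x| / e := by
        rw [le_div_iff₀ he]; linarith [not_le.1 h]
      calc |x| * ∑ i ∈ Finset.range (n + 1), (lilScale (i + 1))⁻¹
          ≤ |x| * (4 * (|x| / e)) := by gcongr; linarith
        _ = 4 / e * x ^ 2 := by rw [← sq_abs x]; ring

section Truncation

variable {Ω : Type*} [MeasurableSpace Ω] {P : Measure Ω} [IsProbabilityMeasure P] {X : ℕ → Ω → ℝ}

theorem summable_integral_tailAt (hX : ∀ i, Measurable (X i))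
    (hident : ∀ i, IdentDistrib (X i) (X 0) P P) (hL2 : MemLp (X 0) 2 P) {e : ℝ} (he : 0 < e) :
    Summable fun i => (∫ ω, tailAt (e * truncLevel (i + 1)) (X i ω) ∂P) / lilScale (i + 1) := by
  have hi0 : Integrable (X 0) P := hL2.integrable (by norm_num)
  have hint : ∀ i : ℕ, Integrable (fun ω => tailAt (e * truncLevel (i + 1)) (X 0 ω)) P :=
    fun i => hi0.mono ((measurable_tailAt _).comp (hX 0)).aestronglyMeasurable
      (Eventually.of_forall fun ω => by
        rw [Real.norm_eq_abs, abs_of_nonneg (tailAt_nonneg _ _)]; exact tailAt_le _ _)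
  refine summable_of_sum_range_le (c := ∫ ω, 4 / e * X 0 ω ^ 2 ∂P) (fun i => ?_) fun n => ?_
  · exact div_nonneg (integral_nonneg fun ω => tailAt_nonneg _ _) (lilScale_nonneg _)
  · have h1 : ∀ i : ℕ, (∫ ω, tailAt (e * truncLevel (i + 1)) (X i ω) ∂P) / lilScale (i + 1) =
        ∫ ω, tailAt (e * truncLevel (i + 1)) (X 0 ω) / lilScale (i + 1) ∂P := fun i => by
      rw [integral_div]
      congr 1
      exact ((hident i).comp (measurable_tailAt _)).integral_eq
    simp_rw [h1]
    rw [← integral_finsetSum _ fun i _ => (hint i).div_const _]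
    exact integral_mono (integrable_finsetSum _ fun i _ => (hint i).div_const _)
      (hL2.integrable_sq.const_mul _) fun ω => sum_tailAt_div_le he _ _

omit [IsProbabilityMeasure P] in
theorem ae_summable_of_summable_integral {f : ℕ → Ω → ℝ} (hf : ∀ i, Integrable (f i) P)
    (hf0 : ∀ i ω, 0 ≤ f i ω) (hs : Summable fun i => ∫ ω, f i ω ∂P) :
    ∀ᵐ ω ∂P, Summable fun i => f i ω := by
  have h1 : ∫⁻ ω, ∑' i, ENNReal.ofReal (f i ω) ∂P ≠ ⊤ := by
    rw [lintegral_tsum fun i => (hf i).aemeasurable.ennreal_ofReal]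
    simp_rw [← fun i => ofReal_integral_eq_lintegral_ofReal (hf i) (Eventually.of_forall (hf0 i))]
    exact hs.tsum_ofReal_ne_top
  filter_upwards [ae_lt_top' (AEMeasurable.tsum
    fun i => (hf i).aemeasurable.ennreal_ofReal) h1] with ω hω
  have := ENNReal.summable_toReal hω.ne
  simpa [fun i => ENNReal.toReal_ofReal (hf0 i ω)] using this

/-- The `i`-th centred truncated variable. -/
noncomputable def centredTrunc (P : Measure Ω) (X : ℕ → Ω → ℝ) (e : ℝ) (i : ℕ) (ω : Ω) : ℝ :=
  truncAt (e * truncLevel (i + 1)) (X i ω) - ∫ ω', truncAt (e * truncLevel (i + 1)) (X i ω') ∂P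

/-- As `X i` is centred, the mean of its truncation is minus the mean of the discarded part. So the
error is controlled by the tails and their expectations, and Kronecker's lemma applies to both. -/
theorem tendsto_sum_sub_centredTrunc (hX : ∀ i, Measurable (X i))
    (hident : ∀ i, IdentDistrib (X i) (X 0) P P) (hL2 : MemLp (X 0) 2 P)
    (hmean : ∫ ω, X 0 ω ∂P = 0) {e : ℝ} (he : 0 < e) :
    ∀ᵐ ω ∂P, Tendsto (fun n => (∑ i ∈ Finset.range n, (X i ω - centredTrunc P X e i ω))
      / lilScale n) atTop (𝓝 0) := by
  have hi0 : Integrable (X 0) P := hL2.integrable (by norm_num)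
  have hi : ∀ i, Integrable (X i) P := fun i => (hident i).integrable_iff.2 hi0
  have htail : ∀ i : ℕ, Integrable (fun ω => tailAt (e * truncLevel (i + 1)) (X i ω)) P :=
    fun i => (hi i).mono ((measurable_tailAt _).comp (hX i)).aestronglyMeasurable
      (Eventually.of_forall fun ω => by
        rw [Real.norm_eq_abs, abs_of_nonneg (tailAt_nonneg _ _)]; exact tailAt_le _ _)
  have htrunc : ∀ i : ℕ, Integrable (fun ω => truncAt (e * truncLevel (i + 1)) (X i ω)) P :=
    fun i => (hi i).mono ((measurable_truncAt _).comp (hX i)).aestronglyMeasurable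
      (Eventually.of_forall fun ω => abs_truncAt_le_abs _ _)
  have hs := summable_integral_tailAt hX hident hL2 he
  have hk := tendsto_sum_div_of_summable (fun n hn => lilScale_pos hn)
    (fun m n h => lilScale_mono h) tendsto_lilScale_atTop
    (fun i => integral_nonneg fun ω => tailAt_nonneg _ _) hs
  have hae := ae_summable_of_summable_integral (P := P)
    (f := fun i ω => tailAt (e * truncLevel (i + 1)) (X i ω) / lilScale (i + 1))
    (fun i => (htail i).div_const _)
    (fun i ω => div_nonneg (tailAt_nonneg _ _) (lilScale_nonneg _))
    (by simpa only [integral_div] using hs)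
  filter_upwards [hae] with ω hω
  have hk' := tendsto_sum_div_of_summable (fun n hn => lilScale_pos hn)
    (fun m n h => lilScale_mono h) tendsto_lilScale_atTop
    (fun i => tailAt_nonneg (e * truncLevel (i + 1)) (X i ω)) hω
  have hsum := hk'.add hk
  rw [add_zero] at hsum
  refine squeeze_zero_norm (fun n => ?_) hsum
  rw [Real.norm_eq_abs, abs_div, abs_of_nonneg (lilScale_nonneg n), ← add_div,
    ← Finset.sum_add_distrib]
  refine div_le_div_of_nonneg_right ?_ (lilScale_nonneg n)
  refine (Finset.abs_sum_le_sum_abs _ _).trans (Finset.sum_le_sum fun i _ => ?_)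
  have hm : ∫ ω', X i ω' ∂P = 0 := (hident i).integral_eq.trans hmean
  have h1 : |∫ ω', truncAt (e * truncLevel (i + 1)) (X i ω') ∂P| ≤
      ∫ ω', tailAt (e * truncLevel (i + 1)) (X i ω') ∂P := by
    have : ∫ ω', truncAt (e * truncLevel (i + 1)) (X i ω') ∂P =
        -∫ ω', (X i ω' - truncAt (e * truncLevel (i + 1)) (X i ω')) ∂P := by
      rw [integral_sub (hi i) (htrunc i), hm]; ring
    rw [this, abs_neg]
    refine abs_integral_le_integral_abs.trans ?_
    simp_rw [abs_sub_truncAt]; exact le_rfl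
  have h2 : X i ω - centredTrunc P X e i ω = (X i ω - truncAt (e * truncLevel (i + 1)) (X i ω)) +
      ∫ ω', truncAt (e * truncLevel (i + 1)) (X i ω') ∂P := by
    unfold centredTrunc; ring
  rw [h2]
  refine (abs_add_le _ _).trans ?_
  rw [abs_sub_truncAt]
  linarith

theorem measure_max_centredTrunc_le (hX : ∀ i, Measurable (X i)) (hindep : iIndepFun X P)
    (hident : ∀ i, IdentDistrib (X i) (X 0) P P) (hL2 : MemLp (X 0) 2 P)
    (hvar : ∫ ω, X 0 ω ^ 2 ∂P = 1) {d : ℝ} (hd : 0 < d) (hd1 : d ≤ 1) {N : ℕ} (hN : 0 < N) :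
    P {ω | ∃ n, 0 < n ∧ n ≤ N ∧
      (1 + d) * lilScale N ≤ ∑ i ∈ Finset.range n, centredTrunc P X (d / 3) i ω} ≤
      ENNReal.ofReal (Real.exp (-((1 + d) * iterLog N))) := by
  have hbd : ∀ i : ℕ, 0 ≤ d / 3 * truncLevel (i + 1) := fun i =>
    mul_nonneg (by linarith) (truncLevel_nonneg _)
  have hYm : ∀ i : ℕ, Measurable fun ω => truncAt (d / 3 * truncLevel (i + 1)) (X i ω) :=
    fun i => (measurable_truncAt _).comp (hX i)
  have hYi : ∀ i : ℕ, Integrable (fun ω => truncAt (d / 3 * truncLevel (i + 1)) (X i ω)) P :=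
    fun i => integrable_of_abs_le (hYm i) fun ω => abs_truncAt_le (hbd i) _
  have hN' : (0 : ℝ) < N := by exact_mod_cast hN
  have hLN := iterLog_pos N
  -- This `l` optimises the Gaussian exponent: `N * l² / 2 = iterLog N`. Centring doubles the level
  -- `d / 3`, and `l * truncLevel N = √2 ≤ 3 / 2` gives `l * B ≤ d`. The exponent is then at most
  -- `(-2 (1 + d) + (1 + d)) * iterLog N`.
  set l := lilScale N / N with hl
  have hlT : l * truncLevel N = √2 := by
    rw [hl, lilScale, truncLevel, div_mul_eq_mul_div, ← Real.sqrt_mul (by positivity)]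
    rw [show 2 * (N : ℝ) * iterLog N * (N / iterLog N) = 2 * N ^ 2 by field_simp,
      Real.sqrt_mul (by norm_num), Real.sqrt_sq hN'.le]
    field_simp
  have hs2 : √2 ≤ 3 / 2 := by
    rw [Real.sqrt_le_left (by norm_num)]; norm_num
  have hlB : l * (2 * (d / 3 * truncLevel N)) ≤ d := by
    have : l * (2 * (d / 3 * truncLevel N)) = 2 * d / 3 * √2 := by rw [← hlT]; ring
    rw [this]; nlinarith
  have key := measure_max_sum_ge_le (P := P) (Z := centredTrunc P X (d / 3))
    (B := 2 * (d / 3 * truncLevel N)) (l := l) (x := (1 + d) * lilScale N) (N := N)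
    (b := fun i => 2 * (d / 3 * truncLevel (i + 1)))
    (fun i => (hYm i).sub_const _) ?_ ?_ ?_ ?_ ?_
    (div_nonneg (lilScale_nonneg _) hN'.le) (hlB.trans hd1)
  · refine key.trans (ENNReal.ofReal_le_ofReal (Real.exp_le_exp.2 ?_))
    have e1 : l * ((1 + d) * lilScale N) = (1 + d) * (2 * iterLog N) := by
      have := lilScale_sq N
      rw [hl]; field_simp; linarith
    have e2 : N * (l ^ 2 / 2 * (1 + l * (2 * (d / 3 * truncLevel N)))) =
        iterLog N * (1 + l * (2 * (d / 3 * truncLevel N))) := by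
      have : N * (l ^ 2 / 2) = iterLog N := by
        rw [hl, div_pow, lilScale_sq]; field_simp
      rw [← mul_assoc, this]
    rw [e1, e2]
    nlinarith
  · exact hindep.comp (fun i x => truncAt (d / 3 * truncLevel (i + 1)) x -
      ∫ ω', truncAt (d / 3 * truncLevel (i + 1)) (X i ω') ∂P)
      fun i => (measurable_truncAt _).sub_const _
  · intro i ω
    have h1 := abs_truncAt_le (hbd i) (X i ω)
    have h2 : |∫ ω', truncAt (d / 3 * truncLevel (i + 1)) (X i ω') ∂P| ≤
        d / 3 * truncLevel (i + 1) := by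
      have := norm_integral_le_of_norm_le_const (μ := P)
        (f := fun ω' => truncAt (d / 3 * truncLevel (i + 1)) (X i ω'))
        (Eventually.of_forall fun ω' => abs_truncAt_le (hbd i) (X i ω'))
      simpa using this
    exact (abs_sub _ _).trans (by linarith)
  · intro i hi
    have := truncLevel_mono i.succ_pos hi
    gcongr
  · intro i
    simp only [centredTrunc]
    rw [integral_sub (hYi i) (integrable_const _)]; simp
  · intro i
    have h1 := variance_le_expectation_sq (μ := P) (hYm i).aestronglyMeasurable
    rw [variance_eq_integral (hYm i).aemeasurable] at h1
    refine h1.trans ?_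
    have hL2i : MemLp (X i) 2 P := (hident i).memLp_iff.2 hL2
    have h2 : ∫ ω, X i ω ^ 2 ∂P = 1 := by
      rw [← hvar]; exact ((hident i).comp (measurable_id.pow_const 2)).integral_eq
    rw [← h2]
    refine integral_mono_of_nonneg (Eventually.of_forall fun ω => sq_nonneg _)
      hL2i.integrable_sq (Eventually.of_forall fun ω => ?_)
    exact sq_le_sq.2 (abs_truncAt_le_abs _ _)

end Truncation

/-! ### The upper half, along a geometric sequence. -/

theorem summable_exp_neg_iterLog_ceil_pow {t d : ℝ} (ht : 1 < t) (hd : 0 < d) :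
    Summable fun k : ℕ => Real.exp (-((1 + d) * iterLog ⌈t ^ (k + 1)⌉₊)) := by
  have hlog : 0 < Real.log t := Real.log_pos ht
  have hs : Summable fun k : ℕ => Real.log t ^ (-(1 + d)) * (((k + 1 : ℕ) : ℝ) ^ (-(1 + d))) :=
    ((summable_nat_add_iff 1).2 (Real.summable_nat_rpow.2 (by linarith))).mul_left _
  refine hs.of_nonneg_of_le (fun k => (Real.exp_pos _).le) fun k => ?_
  have hk : (0 : ℝ) < ((k + 1 : ℕ) : ℝ) := by positivity
  rw [← Real.mul_rpow hlog.le hk.le, Real.rpow_def_of_pos (by positivity)]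
  refine Real.exp_le_exp.2 ?_
  have h1 : Real.log t * ((k + 1 : ℕ) : ℝ) ≤ Real.log (⌈t ^ (k + 1)⌉₊ : ℝ) := by
    rw [mul_comm, ← Real.log_pow]
    exact Real.log_le_log (by positivity) (Nat.le_ceil _)
  have h2 : Real.log (Real.log t * ((k + 1 : ℕ) : ℝ)) ≤ iterLog ⌈t ^ (k + 1)⌉₊ := by
    have := Real.log_le_log (by positivity)
      (h1.trans (by linarith : _ ≤ Real.log (⌈t ^ (k + 1)⌉₊ : ℝ) + 2))
    unfold iterLog; linarith
  nlinarith

theorem exists_ceil_pow_near {t : ℝ} (ht : 1 < t) (K : ℕ) :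
    ∀ᶠ n : ℕ in atTop, ∃ k, K ≤ k ∧ 0 < n ∧ n ≤ ⌈t ^ (k + 1)⌉₊ ∧
      lilScale ⌈t ^ (k + 1)⌉₊ ≤ t ^ 2 * lilScale n := by
  -- The threshold `1 / (t² - t)` absorbs the rounding: `t * n + 1 ≤ t² * n`.
  have htends := tendsto_natCast_atTop_atTop (R := ℝ)
  filter_upwards [htends.eventually_ge_atTop (t ^ K), htends.eventually_ge_atTop (1 / (t ^ 2 - t)),
    eventually_gt_atTop 0] with n hn1 hn2 hn0
  have hn' : (0 : ℝ) < n := by exact_mod_cast hn0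
  obtain ⟨k, hk1, hk2⟩ := exists_nat_pow_near (show (1 : ℝ) ≤ n by exact_mod_cast hn0) ht
  have hle : n ≤ ⌈t ^ (k + 1)⌉₊ := by exact_mod_cast hk2.le.trans (Nat.le_ceil _)
  refine ⟨k, ?_, hn0, hle, ?_⟩
  · have : t ^ K < t ^ (k + 1) := hn1.trans_lt hk2
    exact Nat.lt_succ_iff.1 ((pow_lt_pow_iff_right₀ ht).1 this)
  · have ht2 : 0 < t ^ 2 - t := by nlinarith
    have hN : (⌈t ^ (k + 1)⌉₊ : ℝ) ≤ t ^ 2 * n := by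
      have h1 := (Nat.ceil_lt_add_one (show 0 ≤ t ^ (k + 1) by positivity)).le
      rw [div_le_iff₀ ht2] at hn2
      have : t ^ (k + 1) ≤ t * n := by rw [pow_succ, mul_comm]; gcongr
      nlinarith
    have hL : iterLog ⌈t ^ (k + 1)⌉₊ ≤ iterLog n * t := by
      refine (iterLog_le_mul_sqrt hn0 hle).trans ?_
      have := iterLog_pos n
      gcongr
      rw [Real.sqrt_le_left (by linarith), div_le_iff₀ hn']
      exact hN
    have := iterLog_pos n
    have := iterLog_pos ⌈t ^ (k + 1)⌉₊
    have e : t ^ 2 * lilScale n = √((t ^ 2) ^ 2 * (2 * n * iterLog n)) := by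
      rw [Real.sqrt_mul (by positivity), Real.sqrt_sq (by positivity), lilScale]
    rw [e, lilScale]
    apply Real.sqrt_le_sqrt
    calc 2 * (⌈t ^ (k + 1)⌉₊ : ℝ) * iterLog ⌈t ^ (k + 1)⌉₊
        ≤ 2 * (t ^ 2 * n) * (iterLog n * t) := by gcongr
      _ = t ^ 3 * (2 * n * iterLog n) := by ring
      _ ≤ (t ^ 2) ^ 2 * (2 * n * iterLog n) := by
        rw [← pow_mul]
        exact mul_le_mul_of_nonneg_right (pow_le_pow_right₀ ht.le (by norm_num)) (by positivity)

section Upper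

variable {Ω : Type*} [MeasurableSpace Ω] {P : Measure Ω} [IsProbabilityMeasure P] {X : ℕ → Ω → ℝ}

/-- The upper half of the Hartman-Wintner law of the iterated logarithm. -/
theorem ae_eventually_sum_le_mul_lilScale (hX : ∀ i, Measurable (X i)) (hindep : iIndepFun X P)
    (hident : ∀ i, IdentDistrib (X i) (X 0) P P) (hL2 : MemLp (X 0) 2 P)
    (hmean : ∫ ω, X 0 ω ∂P = 0) (hvar : ∫ ω, X 0 ω ^ 2 ∂P = 1) {c : ℝ} (hc : 1 < c) :
    ∀ᵐ ω ∂P, ∀ᶠ n in atTop, ∑ i ∈ Finset.range n, X i ω ≤ c * lilScale n := by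
  -- One factor `1 + d` comes from the maximal inequality, one from interpolating between geometric
  -- times, and a further `d` from the truncation error.
  set d := min 1 ((c - 1) / 4) with hd
  have hd0 : 0 < d := lt_min one_pos (by linarith)
  have hd1 : d ≤ 1 := min_le_left _ _
  have hdc : (1 + d) ^ 2 + d ≤ c := by
    have : d ≤ (c - 1) / 4 := min_le_right _ _
    nlinarith
  set t := √(1 + d) with ht
  have ht1 : 1 < t := by rw [ht, Real.lt_sqrt (by norm_num)]; linarith
  have ht2 : t ^ 2 = 1 + d := Real.sq_sqrt (by linarith)
  have hbc := ae_eventually_notMem (μ := P) (s := fun k : ℕ => {ω | ∃ n, 0 < n ∧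
    n ≤ ⌈t ^ (k + 1)⌉₊ ∧ (1 + d) * lilScale ⌈t ^ (k + 1)⌉₊ ≤
      ∑ i ∈ Finset.range n, centredTrunc P X (d / 3) i ω}) (by
    refine ne_top_of_le_ne_top
      (summable_exp_neg_iterLog_ceil_pow ht1 hd0).tsum_ofReal_ne_top ?_
    refine ENNReal.tsum_le_tsum fun k => ?_
    exact measure_max_centredTrunc_le hX hindep hident hL2 hvar hd0 hd1
      (Nat.ceil_pos.2 (by positivity)))
  filter_upwards [hbc, tendsto_sum_sub_centredTrunc hX hident hL2 hmean
    (show 0 < d / 3 by linarith)] with ω h1 h2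
  obtain ⟨K, hK⟩ := eventually_atTop.1 h1
  filter_upwards [exists_ceil_pow_near ht1 K, h2.eventually_lt_const hd0] with n hn hn2
  obtain ⟨k, hkK, hn0, hnk, hA⟩ := hn
  have h3 := hK k hkK
  simp only [not_exists, not_and, not_le] at h3
  have h4 := h3 n hn0 hnk
  rw [div_lt_iff₀ (lilScale_pos hn0), Finset.sum_sub_distrib] at hn2
  have hA0 := lilScale_nonneg n
  rw [ht2] at hA
  nlinarith [mul_le_mul_of_nonneg_right hdc hA0]

end Upper

/-! ### Lower bounds for the probability of a large sum over independent blocks. -/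

/-- The tail beyond `c * s` decays roughly like `exp (-(c * s)² / 2)`, and `c² < c` leaves room for
lower-order terms once `s` is large. The density is bounded below on a unit interval, using `√(2π) ≤
e`. -/
theorem exists_exp_lt_gaussianReal_Ioi {c : ℝ} (hc : 0 < c) (hc1 : c < 1) :
    ∃ s, 0 < s ∧ ENNReal.ofReal (Real.exp (-(c * (s ^ 2 / 2)))) <
      gaussianReal 0 1 (Ioi (c * s)) := by
  have hcc : 0 < c * (1 - c) := mul_pos hc (by linarith)
  set s := 5 / (c * (1 - c)) with hs
  have hs0 : 0 < s := by positivity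
  have hs1 : 1 ≤ s := by
    rw [hs, one_le_div hcc]; nlinarith [sq_nonneg (c - 1 / 2)]
  have hc1' : 1 - c ≠ 0 := by linarith
  have hs2 : c * (1 - c) * s = 5 := by rw [hs]; field_simp
  refine ⟨s, hs0, ?_⟩
  have hpdf : ∀ x ∈ Ioc (c * s) (c * s + 1),
      ENNReal.ofReal (Real.exp (-(1 + (c * s + 1) ^ 2 / 2))) ≤ gaussianPDF 0 1 x := by
    intro x hx
    refine ENNReal.ofReal_le_ofReal ?_
    have h1 : √(2 * Real.pi) ≤ Real.exp 1 := by
      rw [Real.sqrt_le_left (Real.exp_pos _).le]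
      nlinarith [Real.pi_lt_d2, Real.exp_one_gt_d9]
    have h2 : (√(2 * Real.pi))⁻¹ ≥ Real.exp (-1) := by
      rw [Real.exp_neg]
      exact inv_anti₀ (by positivity) h1
    have h3 : Real.exp (-((c * s + 1) ^ 2 / 2)) ≤ Real.exp (-(x ^ 2) / 2) := by
      refine Real.exp_le_exp.2 ?_
      have h0 : 0 < c * s := by positivity
      nlinarith [hx.1, hx.2]
    rw [gaussianPDFReal, neg_add, Real.exp_add]
    simp only [NNReal.coe_one, mul_one, sub_zero]
    exact mul_le_mul h2 h3 (Real.exp_pos _).le (by positivity)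
  calc ENNReal.ofReal (Real.exp (-(c * (s ^ 2 / 2))))
      < ENNReal.ofReal (Real.exp (-(1 + (c * s + 1) ^ 2 / 2))) := by
        refine (ENNReal.ofReal_lt_ofReal_iff (Real.exp_pos _)).2 (Real.exp_lt_exp.2 ?_)
        have : c * s ^ 2 - c ^ 2 * s ^ 2 = 5 * s := by rw [← hs2]; ring
        nlinarith
    _ = ENNReal.ofReal (Real.exp (-(1 + (c * s + 1) ^ 2 / 2))) *
        volume (Ioc (c * s) (c * s + 1)) := by simp
    _ ≤ ∫⁻ x in Ioc (c * s) (c * s + 1), gaussianPDF 0 1 x := by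
        rw [← setLIntegral_const]
        exact setLIntegral_mono (measurable_gaussianPDF 0 1) hpdf
    _ = gaussianReal 0 1 (Ioc (c * s) (c * s + 1)) :=
        (gaussianReal_apply 0 one_ne_zero _).symm
    _ ≤ _ := measure_mono Ioc_subset_Ioi_self

section Independence

variable {Ω : Type*} [MeasurableSpace Ω] {P : Measure Ω}

theorem iIndepSet_of_disjoint_iSup {ι κ : Type*} [DecidableEq κ] {m : ι → MeasurableSpace Ω}
    (hm : ∀ i, m i ≤ ‹MeasurableSpace Ω›) (hindep : iIndep m P) {T : κ → Set ι}
    (hT : Pairwise (Function.onFun Disjoint T)) {B : κ → Set Ω}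
    (hB : ∀ k, MeasurableSet[⨆ i ∈ T k, m i] (B k)) : iIndepSet B P := by
  have hle : ∀ S : Set ι, ⨆ i ∈ S, m i ≤ ‹MeasurableSpace Ω› := fun S => iSup₂_le fun i _ => hm i
  rw [iIndepSet_iff_meas_biInter fun k => hle _ _ (hB k)]
  have := hindep.isProbabilityMeasure
  intro s
  induction s using Finset.induction_on with
  | empty => simp
  | insert a s ha ih =>
    rw [Finset.prod_insert ha, ← ih, Finset.set_biInter_insert]
    have hd : Disjoint (T a) (⋃ k ∈ s, T k) := by
      rw [Set.disjoint_iUnion₂_right]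
      exact fun k hk => hT (fun h => ha (h ▸ hk))
    refine (Indep_iff _ _ P).1 (indep_iSup_of_disjoint hm hindep hd) _ _ (hB a) ?_
    refine Finset.measurableSet_biInter s fun k hk => ?_
    refine (iSup₂_le fun i hi => ?_ : ⨆ i ∈ T k, m i ≤ ⨆ i ∈ ⋃ k ∈ s, T k, m i) _ (hB k)
    exact le_iSup₂_of_le i (mem_biUnion hk hi) le_rfl

end Independence

section Blocks

variable {Ω : Type*} [MeasurableSpace Ω] {P : Measure Ω} [IsProbabilityMeasure P] {X : ℕ → Ω → ℝ}

omit [IsProbabilityMeasure P] in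
theorem measure_le_sum_shift (hindep : iIndepFun X P)
    (hident : ∀ i, IdentDistrib (X i) (X 0) P P) (n m : ℕ) (y : ℝ) :
    P {ω | y ≤ ∑ i ∈ Finset.range m, X (n + i) ω} = P {ω | y ≤ ∑ i ∈ Finset.range m, X i ω} := by
  have h := IdentDistrib.pi (X := fun i => X (n + i)) (Y := X) (μ := P) (ν := P)
    (fun i => (hident (n + i)).trans (hident i).symm)
    (hindep.precomp (add_right_injective n)) hindep
  have hs : MeasurableSet {f : ℕ → ℝ | y ≤ ∑ i ∈ Finset.range m, f i} :=
    measurableSet_le measurable_const (Finset.measurable_fun_sum _ fun i _ => measurable_pi_apply i)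
  exact h.measure_mem_eq hs

omit [IsProbabilityMeasure P] in
theorem mul_measure_le_sum (hX : ∀ i, Measurable (X i)) (hindep : iIndepFun X P)
    (hident : ∀ i, IdentDistrib (X i) (X 0) P P) (n m : ℕ) (x y : ℝ) :
    P {ω | x ≤ ∑ i ∈ Finset.range n, X i ω} * P {ω | y ≤ ∑ i ∈ Finset.range m, X i ω} ≤
      P {ω | x + y ≤ ∑ i ∈ Finset.range (n + m), X i ω} := by
  have hd : Disjoint (Finset.range n) (Finset.Ico n (n + m)) := by
    rw [Finset.disjoint_left]; intro i hi hi'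
    exact absurd (Finset.mem_range.1 hi) (not_lt.2 (Finset.mem_Ico.1 hi').1)
  have h1 := hindep.indepFun_finset _ _ hd hX
  have h2 : IndepFun (fun ω => ∑ i ∈ Finset.range n, X i ω)
      (fun ω => ∑ i ∈ Finset.Ico n (n + m), X i ω) P := by
    have := h1.comp (φ := fun f => ∑ i, f i) (ψ := fun f => ∑ i, f i)
      (by fun_prop) (by fun_prop)
    convert! this using 1
    · ext ω; exact (Finset.sum_coe_sort (Finset.range n) fun i => X i ω).symm
    · ext ω; exact (Finset.sum_coe_sort (Finset.Ico n (n + m)) fun i => X i ω).symm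
  rw [← measure_le_sum_shift hindep hident n m y]
  have h3 : ∀ ω, ∑ i ∈ Finset.range m, X (n + i) ω = ∑ i ∈ Finset.Ico n (n + m), X i ω :=
    fun ω => by rw [Finset.sum_Ico_eq_sum_range]; simp
  simp_rw [h3]
  have h4 := h2.measure_inter_preimage_eq_mul (Ici x) (Ici y) measurableSet_Ici measurableSet_Ici
  refine h4.symm.le.trans (measure_mono ?_)
  rintro ω ⟨ha, hb⟩
  have := Finset.sum_range_add_sum_Ico (fun i => X i ω) (Nat.le_add_right n m)
  simp only [mem_preimage, mem_Ici] at ha hb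
  change x + y ≤ _
  linarith

/-- If each of `m` consecutive independent blocks reaches `u`, the total reaches `m * u`. -/
theorem pow_measure_le_sum (hX : ∀ i, Measurable (X i)) (hindep : iIndepFun X P)
    (hident : ∀ i, IdentDistrib (X i) (X 0) P P) (p m : ℕ) (u : ℝ) :
    P {ω | u ≤ ∑ i ∈ Finset.range p, X i ω} ^ m ≤
      P {ω | m * u ≤ ∑ i ∈ Finset.range (m * p), X i ω} := by
  induction m with
  | zero => simp
  | succ m ih =>
    rw [pow_succ, Nat.succ_mul]
    push_cast
    rw [add_mul, one_mul]
    exact (mul_le_mul_left ih _).trans (mul_measure_le_sum hX hindep hident (m * p) p _ u)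

/-- Central limit theorem and the portmanteau inequality for an open half-line; the strict Gaussian
bound yields a bound for all large `p`. -/
theorem eventually_exp_le_measure_sum (hindep : iIndepFun X P)
    (hident : ∀ i, IdentDistrib (X i) (X 0) P P)
    (hmean : ∫ ω, X 0 ω ∂P = 0) (hvar : ∫ ω, X 0 ω ^ 2 ∂P = 1) {c : ℝ} (hc : 0 < c)
    (hc1 : c < 1) :
    ∃ s, 0 < s ∧ ∀ᶠ p : ℕ in atTop, ENNReal.ofReal (Real.exp (-(c * (s ^ 2 / 2)))) ≤
      P {ω | c * s * √p ≤ ∑ i ∈ Finset.range p, X i ω} := by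
  obtain ⟨s, hs, hlt⟩ := exists_exp_lt_gaussianReal_Ioi hc hc1
  refine ⟨s, hs, ?_⟩
  have hclt := tendstoInDistribution_inv_sqrt_mul_sum (P := P) (X := X)
    (P' := gaussianReal 0 1) (Y := id) HasLaw.id hmean hvar hindep hident
  have hopen := ProbabilityMeasure.le_liminf_measure_open_of_tendsto hclt.tendsto
    (isOpen_Ioi (a := c * s))
  simp only [ProbabilityMeasure.coe_mk, Measure.map_id] at hopen
  filter_upwards [eventually_lt_of_lt_liminf (hlt.trans_le hopen), eventually_gt_atTop 0]
    with p hp hp0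
  refine hp.le.trans ?_
  rw [Measure.map_apply_of_aemeasurable (hclt.forall_aemeasurable p) measurableSet_Ioi]
  refine measure_mono fun ω hω => ?_
  have hp' : 0 < √(p : ℝ) := Real.sqrt_pos.2 (by exact_mod_cast hp0)
  simp only [mem_preimage, mem_Ioi] at hω
  rw [inv_mul_eq_div, lt_div_iff₀ hp'] at hω
  exact hω.le

end Blocks

/-! ### The lower half, along the factorials. -/

section Factorial

open scoped Nat

theorem log_factorial_le (k : ℕ) : Real.log (k ! : ℕ) ≤ k * Real.log k := by
  rcases Nat.eq_zero_or_pos k with rfl | hk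
  · simp
  rw [← Real.log_pow]
  exact Real.log_le_log (by exact_mod_cast k.factorial_pos) (by exact_mod_cast k.factorial_le_pow)

theorem exists_mul_iterLog_factorial_le {c : ℝ} (hc : 0 < c) (hc1 : c < 1) :
    ∃ C, ∀ k : ℕ, 0 < k → c * iterLog (k !) ≤ C + Real.log k := by
  -- Chosen so that `c * (1 + e) = 1`: since `log k! ≤ k ^ (1 + e) / e`, its logarithm costs `(1 +
  -- e) * log k` up to a constant.
  set e := 1 / c - 1 with he
  have he0 : 0 < e := by
    have : 1 < 1 / c := by rw [lt_div_iff₀ hc]; linarith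
    linarith
  have hce : c * (1 + e) = 1 := by rw [he]; field_simp; ring
  refine ⟨c * (1 + Real.log (1 / e + 2)), fun k hk => ?_⟩
  have hk' : (0 : ℝ) < k := by exact_mod_cast hk
  have hk1 : (1 : ℝ) ≤ k := by exact_mod_cast hk
  have h1 : Real.log k ≤ (k : ℝ) ^ e / e := Real.log_le_rpow_div hk'.le he0
  have h2 : (1 : ℝ) ≤ (k : ℝ) ^ (1 + e) := Real.one_le_rpow hk1 (by linarith)
  have h3 : Real.log (k ! : ℕ) + 2 ≤ (1 / e + 2) * (k : ℝ) ^ (1 + e) := by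
    have h4 : (k : ℝ) * Real.log k ≤ k * ((k : ℝ) ^ e / e) := by gcongr
    have h5 : (k : ℝ) * ((k : ℝ) ^ e / e) = 1 / e * (k : ℝ) ^ (1 + e) := by
      rw [Real.rpow_add hk', Real.rpow_one]; ring
    linarith [log_factorial_le k]
  have h0 : 0 ≤ Real.log (k ! : ℕ) := Real.log_natCast_nonneg _
  have h6 := Real.log_le_log (by linarith) h3
  rw [Real.log_mul (by positivity) (by positivity), Real.log_rpow hk'] at h6
  calc c * iterLog (k !) ≤ c * (1 + (Real.log (1 / e + 2) + (1 + e) * Real.log k)) := by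
        unfold iterLog; gcongr
    _ = c * (1 + Real.log (1 / e + 2)) + c * (1 + e) * Real.log k := by ring
    _ = _ := by rw [hce, one_mul]

/-- The number of blocks into which the increment of the partial sums ending at `n` is split. -/
noncomputable def blockCount (s : ℝ) (n : ℕ) : ℕ := ⌈2 * iterLog n / s ^ 2⌉₊

/-- The length of the blocks for the increment between `k !` and `(k + 1) !`. -/
noncomputable def blockLength (s : ℝ) (k : ℕ) : ℕ := ((k + 1)! - k !) / blockCount s (k + 1)!

theorem blockCount_pos {s : ℝ} (hs : 0 < s) (n : ℕ) : 0 < blockCount s n :=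
  Nat.ceil_pos.2 (div_pos (mul_pos two_pos (iterLog_pos n)) (by positivity))

theorem factorial_add_block_le (s : ℝ) (k : ℕ) :
    k ! + blockCount s (k + 1)! * blockLength s k ≤ (k + 1)! := by
  have h1 := Nat.mul_div_le ((k + 1)! - k !) (blockCount s (k + 1)!)
  have h2 : k ! ≤ (k + 1)! := Nat.factorial_le k.le_succ
  unfold blockLength
  omega

theorem tendsto_blockCount_div (s : ℝ) :
    Tendsto (fun n => (blockCount s n : ℝ) / n) atTop (𝓝 0) := by
  have h := (tendsto_iterLog_div_natCast.const_mul (2 / s ^ 2)).add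
    tendsto_one_div_atTop_nhds_zero_nat
  rw [mul_zero, add_zero] at h
  refine squeeze_zero (fun n => by positivity) (fun n => ?_) h
  have h1 : (blockCount s n : ℝ) ≤ 2 * iterLog n / s ^ 2 + 1 :=
    (Nat.ceil_lt_add_one (div_nonneg (mul_nonneg two_pos.le (iterLog_pos n).le)
      (sq_nonneg s))).le
  calc (blockCount s n : ℝ) / n ≤ (2 * iterLog n / s ^ 2 + 1) / n := by gcongr
    _ = _ := by ring

theorem tendsto_factorial_atTop : Tendsto Nat.factorial atTop atTop :=
  tendsto_atTop_mono Nat.self_le_factorial tendsto_id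

theorem eventually_mul_blockCount_add_le (s : ℝ) {a b : ℝ} (hb : 0 < b) :
    ∀ᶠ k : ℕ in atTop, a * (blockCount s (k + 1)! : ℝ) + a * (k ! : ℕ) ≤ b * ((k + 1)! : ℕ) := by
  have h1 := (tendsto_blockCount_div s).comp
    (tendsto_factorial_atTop.comp (tendsto_add_atTop_nat 1))
  have h2 := h1.add (tendsto_one_div_add_atTop_nhds_zero_nat (𝕜 := ℝ))
  have h3 := h2.const_mul a
  rw [add_zero, mul_zero] at h3
  filter_upwards [h3.eventually_le_const hb] with k hk
  have hf : (0 : ℝ) < ((k + 1)! : ℕ) := by exact_mod_cast (k + 1).factorial_pos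
  have hk1 : (0 : ℝ) < (k : ℝ) + 1 := by positivity
  have e : (1 : ℝ) / (k + 1) = (k ! : ℕ) / ((k + 1)! : ℕ) := by
    rw [Nat.factorial_succ]; push_cast
    have : (0 : ℝ) < (k ! : ℕ) := by exact_mod_cast k.factorial_pos
    field_simp
  rw [e] at hk
  simp only [Function.comp_apply] at hk
  rw [← add_div, mul_div_assoc', div_le_iff₀ hf] at hk
  linarith

theorem tendsto_blockLength {s : ℝ} (hs : 0 < s) : Tendsto (blockLength s) atTop atTop := by
  refine tendsto_atTop.2 fun q => ?_
  filter_upwards [eventually_mul_blockCount_add_le s (a := q + 1) one_pos] with k hk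
  rw [blockLength, Nat.le_div_iff_mul_le (blockCount_pos hs _)]
  have h1 : (q + 1) * blockCount s (k + 1)! + (q + 1) * k ! ≤ (k + 1)! := by
    rw [one_mul] at hk; exact_mod_cast hk
  have h2 : 1 * k ! ≤ (q + 1) * k ! := Nat.mul_le_mul_right _ (by omega)
  have h3 : q * blockCount s (k + 1)! ≤ (q + 1) * blockCount s (k + 1)! :=
    Nat.mul_le_mul_right _ (by omega)
  omega

/-- With `m ≥ 2 iterLog n / s²` blocks of length `p` and `m * p ≈ n`, the quantity `m * s * √p` is
at least about `lilScale n`. The gap between `c` and `c'` pays for the division remainder and for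
the skipped `k !` terms. -/
theorem eventually_mul_lilScale_le_block {s c c' : ℝ} (hs : 0 < s) (hc : 0 < c) (hcc : c < c') :
    ∀ᶠ k : ℕ in atTop, c * lilScale (k + 1)! ≤
      blockCount s (k + 1)! * (c' * s * √(blockLength s k)) := by
  have hc' : 0 < c' := hc.trans hcc
  have hb : 0 < c' ^ 2 - c ^ 2 := by nlinarith
  filter_upwards [eventually_mul_blockCount_add_le s (a := c' ^ 2) hb] with k hk
  set n := (k + 1)! with hn
  set m := blockCount s n with hm
  set p := blockLength s k with hp
  have hm0 : 0 < m := blockCount_pos hs n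
  have hL := iterLog_pos n
  have hmp : (n : ℝ) ≤ m * p + m + (k ! : ℕ) := by
    have h1 := Nat.div_add_mod ((k + 1)! - k !) m
    have h2 := Nat.mod_lt ((k + 1)! - k !) hm0
    have h3 : m * p + m + k ! ≥ n := by
      have : p = ((k + 1)! - k !) / m := rfl
      rw [← this] at h1
      omega
    exact_mod_cast h3
  have hml : 2 * iterLog n ≤ m * s ^ 2 := by
    have := Nat.le_ceil (2 * iterLog n / s ^ 2)
    rwa [div_le_iff₀ (by positivity)] at this
  refine le_of_sq_le_sq ?_ (by positivity)
  rw [mul_pow, lilScale_sq, mul_pow, mul_pow, mul_pow, Real.sq_sqrt (by positivity)]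
  have h4 : c ^ 2 * n ≤ c' ^ 2 * (m * p) := by
    have := mul_le_mul_of_nonneg_left hmp (sq_nonneg c')
    linarith
  calc c ^ 2 * (2 * n * iterLog n) = (c ^ 2 * n) * (2 * iterLog n) := by ring
    _ ≤ (c' ^ 2 * (m * p)) * (m * s ^ 2) := by gcongr
    _ = _ := by ring

theorem eventually_lilScale_factorial_le {d : ℝ} (hd : 0 < d) :
    ∀ᶠ k : ℕ in atTop, lilScale (k !) ≤ d * lilScale (k + 1)! := by
  filter_upwards [(tendsto_one_div_add_atTop_nhds_zero_nat (𝕜 := ℝ)).eventually_le_const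
    (show 0 < d ^ 2 by positivity)] with k hk
  refine le_of_sq_le_sq ?_ (mul_nonneg hd.le (lilScale_nonneg _))
  rw [mul_pow, lilScale_sq, lilScale_sq]
  have h1 := iterLog_mono (Nat.factorial_le k.le_succ)
  have h2 : ((k ! : ℕ) : ℝ) ≤ d ^ 2 * ((k + 1)! : ℕ) := by
    rw [div_le_iff₀ (by positivity)] at hk
    rw [Nat.factorial_succ]; push_cast
    have : (0 : ℝ) ≤ (k ! : ℕ) := by positivity
    nlinarith
  have h3 := iterLog_pos (k !)
  calc 2 * ((k ! : ℕ) : ℝ) * iterLog (k !) ≤ 2 * (d ^ 2 * ((k + 1)! : ℕ)) * iterLog (k + 1)! := by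
        gcongr
    _ = _ := by ring

section Lower

variable {Ω : Type*} [MeasurableSpace Ω] {P : Measure Ω} [IsProbabilityMeasure P] {X : ℕ → Ω → ℝ}

/-- The block bounds multiply to a constant times `exp (-c' * iterLog (k + 1)!)`; the ceiling in
`blockCount` costs only one constant factor. -/
theorem exists_eventually_le_measure_block (hX : ∀ i, Measurable (X i)) (hindep : iIndepFun X P)
    (hident : ∀ i, IdentDistrib (X i) (X 0) P P)
    (hmean : ∫ ω, X 0 ω ∂P = 0) (hvar : ∫ ω, X 0 ω ^ 2 ∂P = 1) {c : ℝ} (hc : 0 < c)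
    (hc1 : c < 1) :
    ∃ s K : ℝ, 0 < K ∧ ∀ᶠ k : ℕ in atTop, ENNReal.ofReal (K / (k + 1)) ≤
      P {ω | c * lilScale (k + 1)! ≤
        ∑ i ∈ Finset.range (blockCount s (k + 1)! * blockLength s k), X (k ! + i) ω} := by
  obtain ⟨c', hcc, hc'1⟩ := exists_between hc1
  have hc' : 0 < c' := hc.trans hcc
  obtain ⟨s, hs, hev⟩ := eventually_exp_le_measure_sum hindep hident hmean hvar hc' hc'1
  obtain ⟨C, hC⟩ := exists_mul_iterLog_factorial_le hc' hc'1
  refine ⟨s, Real.exp (-(C + c' * (s ^ 2 / 2))), Real.exp_pos _, ?_⟩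
  filter_upwards [(tendsto_blockLength hs).eventually hev,
    eventually_mul_lilScale_le_block hs hc hcc] with k hk1 hk2
  rw [measure_le_sum_shift hindep hident]
  set m := blockCount s (k + 1)! with hm
  set p := blockLength s k with hp
  have hm1 : (m : ℝ) ≤ 2 * iterLog (k + 1)! / s ^ 2 + 1 :=
    (Nat.ceil_lt_add_one (div_nonneg (mul_nonneg two_pos.le (iterLog_pos _).le)
      (sq_nonneg s))).le
  have hm2 : m * (c' * (s ^ 2 / 2)) ≤ Real.log (k + 1) + (C + c' * (s ^ 2 / 2)) := by
    have h1 := mul_le_mul_of_nonneg_right hm1 (show 0 ≤ c' * (s ^ 2 / 2) by positivity)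
    have h2 : (2 * iterLog (k + 1)! / s ^ 2 + 1) * (c' * (s ^ 2 / 2)) =
        c' * iterLog (k + 1)! + c' * (s ^ 2 / 2) := by field_simp
    have h3 := hC (k + 1) k.succ_pos
    push_cast at h3
    linarith
  calc ENNReal.ofReal (Real.exp (-(C + c' * (s ^ 2 / 2))) / (k + 1))
      ≤ ENNReal.ofReal (Real.exp (-(c' * (s ^ 2 / 2))) ^ m) := by
        refine ENNReal.ofReal_le_ofReal ?_
        have hk : (0 : ℝ) < k + 1 := by positivity
        have hinv : ((k : ℝ) + 1)⁻¹ = Real.exp (-Real.log (k + 1)) := by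
          rw [Real.exp_neg, Real.exp_log hk]
        rw [← Real.exp_nat_mul, div_eq_mul_inv, hinv, ← Real.exp_add]
        refine Real.exp_le_exp.2 ?_
        linarith
    _ = ENNReal.ofReal (Real.exp (-(c' * (s ^ 2 / 2)))) ^ m :=
        ENNReal.ofReal_pow (Real.exp_pos _).le _
    _ ≤ P {ω | c' * s * √p ≤ ∑ i ∈ Finset.range p, X i ω} ^ m := by gcongr
    _ ≤ P {ω | m * (c' * s * √p) ≤ ∑ i ∈ Finset.range (m * p), X i ω} :=
        pow_measure_le_sum hX hindep hident p m _
    _ ≤ _ := measure_mono fun ω hω => hk2.trans hω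

theorem tsum_eq_top_of_eventually_ge {f : ℕ → ENNReal} {K : ℝ} (hK : 0 < K)
    (hf : ∀ᶠ k : ℕ in atTop, ENNReal.ofReal (K / (k + 1)) ≤ f k) : ∑' k, f k = ⊤ := by
  by_contra h
  have h1 := ENNReal.summable_toReal h
  have h2 : Summable fun k : ℕ => K / ((k : ℝ) + 1) := by
    refine Summable.of_norm_bounded_eventually_nat h1 ?_
    filter_upwards [hf] with k hk
    have : 0 ≤ K / ((k : ℝ) + 1) := by positivity
    rw [Real.norm_eq_abs, abs_of_nonneg this]
    rw [← ENNReal.ofReal_le_iff_le_toReal (ENNReal.ne_top_of_tsum_ne_top h k)]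
    exact hk
  have h3 : Summable fun k : ℕ => (1 : ℝ) / ((k + 1 : ℕ) : ℝ) := by
    refine (h2.mul_left K⁻¹).congr fun k => ?_
    push_cast
    field_simp
  exact Real.not_summable_one_div_natCast ((summable_nat_add_iff 1).1 h3)

/-- The lower half of the Hartman-Wintner law of the iterated logarithm. -/
theorem ae_frequently_mul_lilScale_le_sum (hX : ∀ i, Measurable (X i)) (hindep : iIndepFun X P)
    (hident : ∀ i, IdentDistrib (X i) (X 0) P P) (hL2 : MemLp (X 0) 2 P)
    (hmean : ∫ ω, X 0 ω ∂P = 0) (hvar : ∫ ω, X 0 ω ^ 2 ∂P = 1) {c : ℝ} (hc : 0 < c)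
    (hc1 : c < 1) :
    ∀ᵐ ω ∂P, ∃ᶠ n in atTop, c * lilScale n ≤ ∑ i ∈ Finset.range n, X i ω := by
  obtain ⟨c', hcc, hc'1⟩ := exists_between hc1
  obtain ⟨s, K, hK, hprob⟩ :=
    exists_eventually_le_measure_block hX hindep hident hmean hvar (hc.trans hcc) hc'1
  set N := fun k => blockCount s (k + 1)! * blockLength s k with hN
  set B := fun k : ℕ => {ω | c' * lilScale (k + 1)! ≤
    ∑ i ∈ Finset.range (N k), X (k ! + i) ω} with hB
  have hBm : ∀ k, MeasurableSet[⨆ i ∈ Ico (k !) (k + 1)!, (borel ℝ).comap (X i)] (B k) := by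
    intro k
    have hm : Measurable[⨆ i ∈ Ico (k !) (k + 1)!, (borel ℝ).comap (X i)]
        fun ω => ∑ i ∈ Finset.range (N k), X (k ! + i) ω := by
      refine Finset.measurable_fun_sum _ fun i hi => ?_
      refine measurable_iff_comap_le.2 ?_
      rw [← BorelSpace.measurable_eq]
      refine le_iSup₂_of_le (k ! + i) ⟨Nat.le_add_right _ _, ?_⟩ ?_
      · have := factorial_add_block_le s k
        have := Finset.mem_range.1 hi
        simp only [hN] at this
        omega
      · exact le_rfl
    exact hm measurableSet_Ici
  have hle : ∀ i, (borel ℝ).comap (X i) ≤ ‹MeasurableSpace Ω› := fun i => by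
    rw [← BorelSpace.measurable_eq]; exact (hX i).comap_le
  have hindepSet : iIndepSet B P := by
    refine iIndepSet_of_disjoint_iSup hle ?_
      (fun i j hij => (Nat.monotone_factorial.pairwise_disjoint_on_Ico_succ) hij) hBm
    have := hindep
    rw [iIndepFun_iff_iIndep] at this
    rw [← BorelSpace.measurable_eq]; exact this
  have hlim := measure_limsup_eq_one (fun k => iSup₂_le (fun i _ => hle i) _ (hBm k)) hindepSet
    (tsum_eq_top_of_eventually_ge hK hprob)
  have hBm' : ∀ k, MeasurableSet (B k) := fun k => iSup₂_le (fun i _ => hle i) _ (hBm k)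
  have hfreq : ∀ᵐ ω ∂P, ω ∈ limsup B atTop :=
    (mem_ae_iff_prob_eq_one (MeasurableSet.measurableSet_limsup hBm')).2 hlim
  -- The sum up to `k !` is at least `-2 * lilScale (k !)`, which is eventually at least `-(c' - c)
  -- * lilScale (k + 1)!`.
  have hneg := ae_eventually_sum_le_mul_lilScale (P := P) (X := fun i => -X i)
    (fun i => (hX i).neg) (hindep.comp (fun _ x => -x) fun _ => measurable_neg)
    (fun i => (hident i).comp measurable_neg) hL2.neg
    (by simp [integral_neg, hmean]) (by simpa using hvar) (c := 2) (by norm_num)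
  filter_upwards [hfreq, hneg] with ω h1 h2
  rw [mem_limsup_iff_frequently_mem] at h1
  have hd : 0 < (c' - c) / 2 := by linarith
  have h3 := h1.and_eventually ((eventually_lilScale_factorial_le hd).and
    (tendsto_factorial_atTop.eventually h2))
  have ht : Tendsto (fun k => k ! + N k) atTop atTop :=
    tendsto_atTop_mono (fun k => Nat.le_add_right _ _) tendsto_factorial_atTop
  refine ht.frequently (h3.mono ?_)
  rintro k ⟨hk1, hk2, hk3⟩
  have hk1' : c' * lilScale (k + 1)! ≤ ∑ i ∈ Finset.range (N k), X (k ! + i) ω := hk1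
  rw [Finset.sum_range_add]
  simp only [Pi.neg_apply, Finset.sum_neg_distrib] at hk3
  have hk4 := lilScale_mono (factorial_add_block_le s k)
  have : c * lilScale (k ! + N k) ≤ c * lilScale (k + 1)! := mul_le_mul_of_nonneg_left hk4 hc.le
  nlinarith

end Lower

end Factorial

/-! ### The exact normalisation and the Hartman-Wintner law. -/

/-- The normalisation `√(2 n⁻¹ log log n)` of sample means in the law of the iterated logarithm. -/
noncomputable def lilRate (n : ℕ) : ℝ := √(2 * (n : ℝ)⁻¹ * Real.log (Real.log n))

theorem eventually_log_log_pos : ∀ᶠ n : ℕ in atTop, 0 < Real.log (Real.log n) :=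
  (Real.tendsto_log_atTop.comp tendsto_log_natCast_atTop).eventually_gt_atTop 0

theorem eventually_lilRate_pos : ∀ᶠ n : ℕ in atTop, 0 < lilRate n := by
  filter_upwards [eventually_log_log_pos, eventually_gt_atTop 0] with n h hn
  have : (0 : ℝ) < n := by exact_mod_cast hn
  unfold lilRate; positivity

theorem eventually_mul_lilRate_le_lilScale : ∀ᶠ n : ℕ in atTop, n * lilRate n ≤ lilScale n := by
  filter_upwards [eventually_log_log_pos, eventually_gt_atTop 0,
    tendsto_log_natCast_atTop.eventually_gt_atTop 0] with n h hn hl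
  have hn' : (0 : ℝ) < n := by exact_mod_cast hn
  have := Real.log_le_log hl (show Real.log n ≤ Real.log n + 2 by linarith)
  refine le_of_sq_le_sq ?_ (lilScale_nonneg n)
  rw [mul_pow, lilRate, Real.sq_sqrt (by positivity), lilScale_sq]
  calc (n : ℝ) ^ 2 * (2 * (n : ℝ)⁻¹ * Real.log (Real.log n)) =
      2 * n * Real.log (Real.log n) := by field_simp
    _ ≤ _ := by unfold iterLog; gcongr; linarith

theorem eventually_lilScale_le_mul_lilRate {r : ℝ} (hr : 1 < r) :
    ∀ᶠ n : ℕ in atTop, lilScale n ≤ r * (n * lilRate n) := by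
  filter_upwards [eventually_log_log_pos, eventually_gt_atTop 0,
    tendsto_iterLog_div_log_log.eventually_le_const (show 1 < r ^ 2 by nlinarith)] with n h hn hl
  have hn' : (0 : ℝ) < n := by exact_mod_cast hn
  have hnn : 0 ≤ lilRate n := Real.sqrt_nonneg _
  refine le_of_sq_le_sq ?_ (by positivity)
  rw [mul_pow, mul_pow, lilRate, Real.sq_sqrt (by positivity), lilScale_sq]
  rw [div_le_iff₀ h] at hl
  calc 2 * n * iterLog n ≤ 2 * n * (r ^ 2 * Real.log (Real.log n)) := by gcongr
    _ = _ := by field_simp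

theorem tendsto_lilRate_mul_rpow {g : ℝ} (hg : g < 1 / 2) :
    Tendsto (fun n : ℕ => lilRate n * (n : ℝ) ^ g) atTop (𝓝 0) := by
  have h1 := ((isLittleO_log_rpow_atTop
    (show 0 < 1 - 2 * g by linarith)).comp_tendsto
      (tendsto_natCast_atTop_atTop (R := ℝ))).tendsto_div_nhds_zero
  have h2 := (h1.const_mul 2)
  rw [mul_zero] at h2
  have h3 := (Real.continuous_sqrt.tendsto 0).comp h2
  rw [Real.sqrt_zero] at h3
  refine squeeze_zero' (Eventually.of_forall fun n => ?_) ?_ h3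
  · exact mul_nonneg (Real.sqrt_nonneg _) (by positivity)
  · filter_upwards [eventually_log_log_pos, eventually_gt_atTop 0,
      tendsto_log_natCast_atTop.eventually_gt_atTop 0] with n h hn hl
    have hn' : (0 : ℝ) < n := by exact_mod_cast hn
    simp only [Function.comp_apply]
    refine Real.le_sqrt_of_sq_le ?_
    rw [mul_pow, lilRate, Real.sq_sqrt (by positivity)]
    have e : (n : ℝ) ^ (1 - 2 * g) = n / ((n : ℝ) ^ g) ^ 2 := by
      rw [Real.rpow_sub hn', Real.rpow_one, mul_comm, Real.rpow_mul hn'.le]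
      norm_cast
    rw [e]
    have := Real.log_le_self hl.le
    have hp : 0 < (n : ℝ) ^ g := by positivity
    calc 2 * (n : ℝ)⁻¹ * Real.log (Real.log n) * ((n : ℝ) ^ g) ^ 2
        ≤ 2 * (n : ℝ)⁻¹ * Real.log n * ((n : ℝ) ^ g) ^ 2 := by gcongr
      _ = _ := by field_simp

theorem tendsto_lilRate : Tendsto lilRate atTop (𝓝 0) := by
  simpa using tendsto_lilRate_mul_rpow (g := 0) (by norm_num)

section LIL

variable {Ω : Type*} [MeasurableSpace Ω] {P : Measure Ω} [IsProbabilityMeasure P] {X : ℕ → Ω → ℝ}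

/-- The **Hartman-Wintner law of the iterated logarithm** for variables of variance one. -/
theorem ae_lil_of_variance_one (hX : ∀ i, Measurable (X i)) (hindep : iIndepFun X P)
    (hident : ∀ i, IdentDistrib (X i) (X 0) P P) (hL2 : MemLp (X 0) 2 P)
    (hmean : ∫ ω, X 0 ω ∂P = 0) (hvar : ∫ ω, X 0 ω ^ 2 ∂P = 1) :
    ∀ᵐ ω ∂P,
      (∀ c, 1 < c → ∀ᶠ n in atTop, ∑ i ∈ Finset.range n, X i ω ≤ c * (n * lilRate n)) ∧
      (∀ c, c < 1 → ∃ᶠ n in atTop, c * (n * lilRate n) ≤ ∑ i ∈ Finset.range n, X i ω) := by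
  -- Rational constants keep the exceptional null sets countable in number.
  have h1 : ∀ᵐ ω ∂P, ∀ c : ℚ, (1 : ℝ) < c → ∀ᶠ n in atTop,
      ∑ i ∈ Finset.range n, X i ω ≤ c * lilScale n := by
    refine ae_all_iff.2 fun c => ?_
    by_cases hc : (1 : ℝ) < c
    · filter_upwards [ae_eventually_sum_le_mul_lilScale hX hindep hident hL2 hmean hvar hc] with ω h _
      exact h
    · exact Eventually.of_forall fun ω h => absurd h hc
  have h2 : ∀ᵐ ω ∂P, ∀ c : ℚ, (0 : ℝ) < c → (c : ℝ) < 1 → ∃ᶠ n in atTop,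
      c * lilScale n ≤ ∑ i ∈ Finset.range n, X i ω := by
    refine ae_all_iff.2 fun c => ?_
    by_cases hc : (0 : ℝ) < c ∧ (c : ℝ) < 1
    · filter_upwards [ae_frequently_mul_lilScale_le_sum hX hindep hident hL2 hmean hvar hc.1 hc.2]
        with ω h _ _
      exact h
    · exact Eventually.of_forall fun ω h h' => absurd ⟨h, h'⟩ hc
  filter_upwards [h1, h2] with ω h1 h2
  refine ⟨fun c hc => ?_, fun c hc => ?_⟩
  · obtain ⟨c', hc1, hc2⟩ := exists_rat_btwn hc
    have hc0 : (0 : ℝ) < c' := by linarith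
    have hr : 1 < c / c' := by rw [lt_div_iff₀ hc0]; linarith
    filter_upwards [h1 c' hc1, eventually_lilScale_le_mul_lilRate hr] with n hn hn2
    refine hn.trans ((mul_le_mul_of_nonneg_left hn2 hc0.le).trans_eq ?_)
    field_simp
  · obtain ⟨c', hc1, hc2⟩ := exists_rat_btwn (max_lt hc one_pos)
    refine ((h2 c' ((le_max_right _ _).trans_lt hc1) hc2).and_eventually
      eventually_mul_lilRate_le_lilScale).mono fun n hn => ?_
    have h0 : (0 : ℝ) ≤ n * lilRate n := mul_nonneg n.cast_nonneg (Real.sqrt_nonneg _)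
    have h3 : c ≤ c' := ((le_max_left _ _).trans_lt hc1).le
    have h4 : (0 : ℝ) ≤ c' := ((le_max_right _ _).trans_lt hc1).le
    exact (mul_le_mul h3 hn.2 h0 h4).trans hn.1

/-- The **Hartman-Wintner law of the iterated logarithm**. -/
theorem ae_lil (hX : ∀ i, Measurable (X i)) (hindep : iIndepFun X P)
    (hident : ∀ i, IdentDistrib (X i) (X 0) P P) (hL2 : MemLp (X 0) 2 P)
    (hmean : ∫ ω, X 0 ω ∂P = 0) (hvar : 0 < ∫ ω, X 0 ω ^ 2 ∂P) :
    ∀ᵐ ω ∂P,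
      (∀ c, √(∫ ω, X 0 ω ^ 2 ∂P) < c →
        ∀ᶠ n in atTop, (∑ i ∈ Finset.range n, X i ω) / (n * lilRate n) ≤ c) ∧
      (∀ c, c < √(∫ ω, X 0 ω ^ 2 ∂P) →
        ∃ᶠ n in atTop, c ≤ (∑ i ∈ Finset.range n, X i ω) / (n * lilRate n)) := by
  set s := √(∫ ω, X 0 ω ^ 2 ∂P) with hs
  have hs0 : 0 < s := Real.sqrt_pos.2 hvar
  have hs2 : s ^ 2 = ∫ ω, X 0 ω ^ 2 ∂P := Real.sq_sqrt hvar.le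
  have h := ae_lil_of_variance_one (P := P) (X := fun i ω => s⁻¹ * X i ω)
    (fun i => (hX i).const_mul _) (hindep.comp (fun _ x => s⁻¹ * x) fun _ => by fun_prop)
    (fun i => (hident i).comp (u := fun x => s⁻¹ * x) (by fun_prop)) (hL2.const_mul _)
    (by rw [integral_const_mul, hmean, mul_zero])
    (by simp_rw [mul_pow]; rw [integral_const_mul, ← hs2]; field_simp)
  have hpos : ∀ᶠ n : ℕ in atTop, 0 < n * lilRate n := by
    filter_upwards [eventually_lilRate_pos, eventually_gt_atTop 0] with n h1 h2
    have : (0 : ℝ) < n := by exact_mod_cast h2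
    positivity
  filter_upwards [h] with ω hω
  simp_rw [← Finset.mul_sum] at hω
  refine ⟨fun c hc => ?_, fun c hc => ?_⟩
  · filter_upwards [hω.1 (c / s) (by rwa [one_lt_div hs0]), hpos] with n hn hn0
    rw [div_le_iff₀ hn0]
    rw [inv_mul_eq_div, div_mul_eq_mul_div, div_le_div_iff_of_pos_right hs0] at hn
    exact hn
  · refine ((hω.2 (c / s) (by rwa [div_lt_one hs0])).and_eventually hpos).mono ?_
    rintro n ⟨hn, hn0⟩
    rw [le_div_iff₀ hn0]
    rw [inv_mul_eq_div, div_mul_eq_mul_div, div_le_div_iff_of_pos_right hs0] at hn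
    exact hn

end LIL

/-! ### Transfer of upper and lower limits, and control of the remainder. -/

theorem EReal.limsup_coe_eq {u : ℕ → ℝ} {a : ℝ} (h1 : ∀ c, a < c → ∀ᶠ n in atTop, u n ≤ c)
    (h2 : ∀ c, c < a → ∃ᶠ n in atTop, c ≤ u n) :
    limsup (fun n => (u n : EReal)) atTop = (a : EReal) := by
  refine le_antisymm (EReal.le_of_forall_lt_iff_le.1 fun c hc => ?_)
    (EReal.ge_of_forall_gt_iff_ge.1 fun c hc => ?_)
  · refine limsup_le_of_le (by isBoundedDefault) ?_
    filter_upwards [h1 c (EReal.coe_lt_coe_iff.1 hc)] with n hn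
    exact EReal.coe_le_coe_iff.2 hn
  · refine le_limsup_of_frequently_le ?_ (by isBoundedDefault)
    exact (h2 c (EReal.coe_lt_coe_iff.1 hc)).mono fun n hn => EReal.coe_le_coe_iff.2 hn

/-- If `u n < c` (resp. `c < u n`) is implied by `s n + g n < 0` (resp. `0 < s n + g n`) for
a sequence `g n` with limit `-c m`, then `u` inherits the upper limit of `s / m`. -/
theorem EReal.limsup_eq_of_comparison {s u : ℕ → ℝ} {a m : ℝ} (hm : 0 < m)
    (h1 : ∀ c, a < c → ∀ᶠ n in atTop, s n ≤ c) (h2 : ∀ c, c < a → ∃ᶠ n in atTop, c ≤ s n)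
    (hu : ∀ c, ∃ g : ℕ → ℝ, Tendsto g atTop (𝓝 (-(c * m))) ∧
      ∀ᶠ n in atTop, (s n + g n < 0 → u n < c) ∧ (0 < s n + g n → c < u n)) :
    limsup (fun n => (u n : EReal)) atTop = ((a / m : ℝ) : EReal) := by
  refine EReal.limsup_coe_eq (fun c hc => ?_) fun c hc => ?_
  · obtain ⟨g, hg, hev⟩ := hu c
    rw [div_lt_iff₀ hm] at hc
    obtain ⟨b, hb1, hb2⟩ := exists_between hc
    filter_upwards [h1 b hb1, hg.eventually_lt_const (neg_lt_neg hb2), hev] with n hn1 hn2 hn3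
    exact (hn3.1 (by linarith)).le
  · obtain ⟨g, hg, hev⟩ := hu c
    rw [lt_div_iff₀ hm] at hc
    obtain ⟨b, hb1, hb2⟩ := exists_between hc
    refine ((h2 b hb2).and_eventually
      ((hg.eventually_const_lt (neg_lt_neg hb1)).and hev)).mono ?_
    rintro n ⟨hn1, hn2, hn3⟩
    exact (hn3.2 (by linarith)).le

theorem EReal.liminf_eq_of_comparison {s u : ℕ → ℝ} {a m : ℝ} (hm : 0 < m)
    (h1 : ∀ c, a < c → ∀ᶠ n in atTop, -s n ≤ c) (h2 : ∀ c, c < a → ∃ᶠ n in atTop, c ≤ -s n)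
    (hu : ∀ c, ∃ g : ℕ → ℝ, Tendsto g atTop (𝓝 (-(c * m))) ∧
      ∀ᶠ n in atTop, (s n + g n < 0 → u n < c) ∧ (0 < s n + g n → c < u n)) :
    liminf (fun n => (u n : EReal)) atTop = ((-(a / m) : ℝ) : EReal) := by
  have h := EReal.limsup_eq_of_comparison (s := fun n => -s n) (u := fun n => -u n) hm h1 h2 ?_
  · have h3 : (fun n => ((-u n : ℝ) : EReal)) = -fun n => (u n : EReal) := by
      ext n; simp
    rw [h3, EReal.limsup_neg, neg_eq_iff_eq_neg] at h
    rw [h, EReal.coe_neg]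
  · intro c
    obtain ⟨g, hg, hev⟩ := hu (-c)
    refine ⟨fun n => -g n, by simpa using hg.neg, ?_⟩
    filter_upwards [hev] with n hn
    exact ⟨fun h => by linarith [hn.2 (by linarith)], fun h => by linarith [hn.1 (by linarith)]⟩

theorem sum_le_rpow_sum_rpow {q : ℝ} (hq : 0 < q) (hq1 : q ≤ 1) {f : ℕ → ℝ} (hf : ∀ i, 0 ≤ f i)
    (n : ℕ) : ∑ i ∈ Finset.range n, f i ≤ (∑ i ∈ Finset.range n, f i ^ q) ^ (1 / q) := by
  have key : (∑ i ∈ Finset.range n, f i) ^ q ≤ ∑ i ∈ Finset.range n, f i ^ q := by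
    induction n with
    | zero => simp [hq.ne']
    | succ n ih =>
      rw [Finset.sum_range_succ, Finset.sum_range_succ]
      have h0 : 0 ≤ ∑ i ∈ Finset.range n, f i := Finset.sum_nonneg fun i _ => hf i
      have h2 : (∑ i ∈ Finset.range n, f i + f n) ^ q ≤
          (∑ i ∈ Finset.range n, f i) ^ q + f n ^ q := Real.rpow_add_le_add_rpow h0 (hf n) hq.le hq1
      linarith
  have h0 : 0 ≤ ∑ i ∈ Finset.range n, f i := Finset.sum_nonneg fun i _ => hf i
  have h1 := Real.rpow_le_rpow (by positivity) key (show 0 ≤ 1 / q by positivity)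
  rwa [← Real.rpow_mul h0, mul_one_div_cancel hq.ne', Real.rpow_one] at h1

/-- If `α = 0`, then `h` tends to zero and the averages converge. If `α > 0`, then `h s ≤ C * s ^ α`
near zero, while subadditivity of `x ^ q` bounds the average by a convergent factor times `n ^ (1/q
- 1)`. -/
theorem tendsto_modulus_mul_average {r α q c K : ℝ} {h : ℝ → ℝ} {f : ℕ → ℝ} (hr : 0 < r)
    (hαq : (α = 0 ∧ q = 1) ∨ (0 < α ∧ q ∈ Ioo (2 / (2 + α)) 1))
    (hh : ∀ s ∈ Ioo 0 r, 0 ≤ h s)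
    (hlim0 : α = 0 → limsup (fun s : ℝ => ((h s / s ^ α : ℝ) : EReal)) (𝓝[>] 0) = 0)
    (hlim : 0 < α → limsup (fun s : ℝ => ((h s / s ^ α : ℝ) : EReal)) (𝓝[>] 0) < ⊤)
    (hf : ∀ i, 0 ≤ f i)
    (hK : Tendsto (fun n : ℕ => (∑ i ∈ Finset.range n, f i ^ q) / n) atTop (𝓝 K))
    (hc : 0 < c) :
    Tendsto (fun n : ℕ => h (c * lilRate n) * ((∑ i ∈ Finset.range n, f i) / n)) atTop (𝓝 0) := by
  have hw : Tendsto (fun n => c * lilRate n) atTop (𝓝[>] 0) := by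
    refine tendsto_nhdsWithin_iff.2 ⟨by simpa using tendsto_lilRate.const_mul c, ?_⟩
    filter_upwards [eventually_lilRate_pos] with n hn
    exact mul_pos hc hn
  have hh' : ∀ᶠ s in 𝓝[>] (0 : ℝ), 0 ≤ h s := by
    filter_upwards [Ioo_mem_nhdsGT hr] with s hs using hh s hs
  rcases hαq with ⟨rfl, rfl⟩ | ⟨hα, hq1, hq2⟩
  · have h0 : Tendsto h (𝓝[>] 0) (𝓝 0) := by
      refine tendsto_order.2 ⟨fun a ha => ?_, fun a ha => ?_⟩
      · filter_upwards [hh'] with s hs using ha.trans_le hs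
      · have hlt : limsup (fun s : ℝ => ((h s / s ^ (0 : ℝ) : ℝ) : EReal)) (𝓝[>] 0) <
            (a : EReal) := by
          rw [hlim0 rfl]; exact_mod_cast ha
        filter_upwards [eventually_lt_of_limsup_lt hlt] with s hs
        simpa using EReal.coe_lt_coe_iff.1 hs
    simpa using (h0.comp hw).mul hK
  · obtain ⟨C, hC, -⟩ := EReal.lt_iff_exists_real_btwn.1 (hlim hα)
    have hq0 : 0 < q := lt_trans (by positivity) hq1
    -- The growth `n ^ (1/q - 1)` equals `(n ^ g) ^ α`, and `q > 2 / (2 + α)` says exactly that `g <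
    -- 1 / 2`.
    set g := (1 / q - 1) / α with hg
    have hg2 : g < 1 / 2 := by
      rw [hg, div_lt_iff₀ hα, sub_lt_iff_lt_add, div_lt_iff₀ hq0]
      rw [div_lt_iff₀ (by linarith)] at hq1
      linarith
    have hgα : g * α = 1 / q - 1 := by rw [hg]; field_simp
    have hbound : ∀ᶠ s in 𝓝[>] (0 : ℝ), h s ≤ C * s ^ α := by
      filter_upwards [eventually_lt_of_limsup_lt hC, self_mem_nhdsWithin] with s hs hs0
      have := EReal.coe_lt_coe_iff.1 hs
      rw [div_lt_iff₀ (Real.rpow_pos_of_pos hs0 α)] at this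
      exact this.le
    have hrate := ((tendsto_lilRate_mul_rpow hg2).rpow_const (p := α) (Or.inr hα.le))
    rw [Real.zero_rpow hα.ne'] at hrate
    have havg := hK.rpow_const (p := 1 / q) (Or.inr (by positivity))
    have hprod := ((hrate.const_mul (C * c ^ α)).mul havg)
    rw [mul_zero, zero_mul] at hprod
    refine squeeze_zero' ?_ ?_ hprod
    · filter_upwards [hw.eventually hh'] with n hn
      exact mul_nonneg hn (div_nonneg (Finset.sum_nonneg fun i _ => hf i) n.cast_nonneg)
    · filter_upwards [hw.eventually hh', hw.eventually hbound, eventually_lilRate_pos,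
        eventually_gt_atTop 0] with n hn1 hn2 hn3 hn4
      have hn' : (0 : ℝ) < n := by exact_mod_cast hn4
      have hS : 0 ≤ ∑ i ∈ Finset.range n, f i ^ q :=
        Finset.sum_nonneg fun i _ => Real.rpow_nonneg (hf i) q
      have h1 : (∑ i ∈ Finset.range n, f i) / n ≤
          ((∑ i ∈ Finset.range n, f i ^ q) / n) ^ (1 / q) * (n : ℝ) ^ (1 / q - 1) := by
        rw [Real.div_rpow hS hn'.le, Real.rpow_sub hn', Real.rpow_one]
        have hp : 0 < (n : ℝ) ^ (1 / q) := by positivity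
        rw [div_mul_div_cancel₀ hp.ne']
        gcongr
        exact sum_le_rpow_sum_rpow hq0 hq2.le hf n
      calc h (c * lilRate n) * ((∑ i ∈ Finset.range n, f i) / n)
          ≤ (C * (c * lilRate n) ^ α) * (((∑ i ∈ Finset.range n, f i ^ q) / n) ^ (1 / q) *
            (n : ℝ) ^ (1 / q - 1)) := by
              refine mul_le_mul hn2 h1 ?_ (hn1.trans hn2)
              exact div_nonneg (Finset.sum_nonneg fun i _ => hf i) hn'.le
        _ = _ := by
              rw [Real.mul_rpow hc.le hn3.le, Real.mul_rpow hn3.le (by positivity),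
                ← Real.rpow_mul hn'.le, hgα]
              ring

/-! ### Deviation means: measurability, sampling and the expansion at `t₀`. -/

section Deviation

variable {I : Set ℝ} {D : ℝ → ℝ → ℝ}

theorem IsDeviation.deviationMean_spec (hI : I.OrdConnected) (hD : IsDeviation I D) {n : ℕ}
    (hn : 0 < n) (x : Fin n → ℝ) (hx : ∀ i, x i ∈ I) :
    deviationMean I D n x ∈ I ∧ ∑ i, D (x i) (deviationMean I D n x) = 0 := by
  have h := (hD.existsUnique hI hn x hx).exists
  rw [deviationMean, dif_pos h]
  exact h.choose_spec

theorem IsDeviation.deviationMean_lt (hI : I.OrdConnected) (hD : IsDeviation I D) {n : ℕ}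
    (hn : 0 < n) (x : Fin n → ℝ) (hx : ∀ i, x i ∈ I) {t : ℝ} (ht : t ∈ I)
    (h : ∑ i, D (x i) t < 0) : deviationMean I D n x < t := by
  obtain ⟨hM, hM0⟩ := hD.deviationMean_spec hI hn x hx
  by_contra! hle
  have := Finset.sum_le_sum fun i (_ : i ∈ Finset.univ) =>
    (hD.strictAntiOn (x i) (hx i)).antitoneOn ht hM hle
  beta_reduce at this
  linarith

theorem IsDeviation.lt_deviationMean (hI : I.OrdConnected) (hD : IsDeviation I D) {n : ℕ}
    (hn : 0 < n) (x : Fin n → ℝ) (hx : ∀ i, x i ∈ I) {t : ℝ} (ht : t ∈ I)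
    (h : 0 < ∑ i, D (x i) t) : t < deviationMean I D n x := by
  obtain ⟨hM, hM0⟩ := hD.deviationMean_spec hI hn x hx
  by_contra! hle
  have := Finset.sum_le_sum fun i (_ : i ∈ Finset.univ) =>
    (hD.strictAntiOn (x i) (hx i)).antitoneOn hM ht hle
  beta_reduce at this
  linarith

/-- Limit theorems need Borel functions on `ℝ`; extension by zero outside `I` supplies them and
changes nothing almost surely. -/
theorem measurable_indicator_of_subtype {f : ℝ → ℝ} (hI : MeasurableSet I)
    (hf : Measurable fun x : I => f x) : Measurable (I.indicator f) := by
  refine measurable_of_restrict_of_restrict_compl hI ?_ ?_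
  · convert! hf using 1
    ext x
    exact indicator_of_mem x.2 f
  · convert! measurable_const (a := (0 : ℝ)) using 1
    ext x
    exact indicator_of_notMem x.2 f

/-- The derivative is a pointwise limit of measurable difference quotients along a sequence in `I`.
-/
theorem measurable_partialSnd {t₀ r : ℝ} (hr : 0 < r) (hrI : Ioo (t₀ - r) (t₀ + r) ⊆ I)
    (hDmeas : IsBorelMeasurableFst I D)
    (hdiff : ∀ x ∈ I, DifferentiableWithinAt ℝ (fun s => D x s) I t₀) :
    Measurable fun x : I => partialSnd I D x t₀ := by
  set u : ℕ → ℝ := fun k => t₀ + r / 2 * (1 / ((k : ℝ) + 1)) with hu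
  have hpos : ∀ k : ℕ, 0 < r / 2 * (1 / ((k : ℝ) + 1)) := fun k => by positivity
  have huI : ∀ k, u k ∈ I := by
    intro k
    have h1 : 1 / ((k : ℝ) + 1) ≤ 1 := by
      rw [div_le_one (by positivity)]; linarith [k.cast_nonneg (α := ℝ)]
    have := hpos k
    refine hrI ⟨by simp only [hu]; linarith, by simp only [hu]; nlinarith⟩
  have ht₀ : t₀ ∈ I := hrI ⟨by linarith, by linarith⟩
  have hlim : Tendsto u atTop (𝓝[I \ {t₀}] t₀) := by
    refine tendsto_nhdsWithin_iff.2 ⟨?_, Eventually.of_forall fun k => ⟨huI k, ?_⟩⟩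
    · have := ((tendsto_one_div_add_atTop_nhds_zero_nat (𝕜 := ℝ)).const_mul (r / 2)).const_add t₀
      simpa [hu] using this
    · have := hpos k
      simp only [hu, mem_singleton_iff]; linarith
  refine measurable_of_tendsto_metrizable
    (f := fun k (x : I) => slope (fun s => D x s) t₀ (u k)) (fun k => ?_) ?_
  · simp only [slope_def_field]
    exact ((hDmeas _ (huI k)).sub (hDmeas _ ht₀)).div_const _
  · refine tendsto_pi_nhds.2 fun x => ?_
    exact (hasDerivWithinAt_iff_tendsto_slope.1 (hdiff x x.2).hasDerivWithinAt).comp hlim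

section Sampling

variable {Ω : Type*} [MeasurableSpace Ω] {P : Measure Ω} {ξ : ℕ → Ω → ℝ}

theorem ae_forall_mem (hI : MeasurableSet I) (hident : ∀ n, IdentDistrib (ξ n) (ξ 0) P P)
    (hξI : ∀ᵐ ω ∂P, ξ 0 ω ∈ I) : ∀ᵐ ω ∂P, ∀ n, ξ n ω ∈ I :=
  ae_all_iff.2 fun n => (hident n).symm.ae_snd hI hξI

theorem ae_tendsto_average (hI : MeasurableSet I)
    (hindep : iIndepFun ξ P) (hident : ∀ n, IdentDistrib (ξ n) (ξ 0) P P)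
    (hξI : ∀ᵐ ω ∂P, ξ 0 ω ∈ I) {f : ℝ → ℝ} (hf : Measurable fun x : I => f x)
    (hint : Integrable (fun ω => f (ξ 0 ω)) P) :
    ∀ᵐ ω ∂P, Tendsto (fun n : ℕ => (∑ i ∈ Finset.range n, f (ξ i ω)) / n) atTop
      (𝓝 (∫ ω, f (ξ 0 ω) ∂P)) := by
  have hm := measurable_indicator_of_subtype hI hf
  have heq : (fun ω => I.indicator f (ξ 0 ω)) =ᵐ[P] fun ω => f (ξ 0 ω) := by
    filter_upwards [hξI] with ω hω
    exact indicator_of_mem hω f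
  have h := strong_law_ae_real (μ := P) (fun i ω => I.indicator f (ξ i ω)) (hint.congr heq.symm)
    (fun i j hij => (hindep.indepFun hij).comp hm hm) (fun i => (hident i).comp hm)
  rw [integral_congr_ae heq] at h
  filter_upwards [h, ae_forall_mem hI hident hξI] with ω h1 h2
  refine h1.congr fun n => ?_
  congr 1
  exact Finset.sum_congr rfl fun i _ => indicator_of_mem (h2 i) f

theorem ae_lil_comp [IsProbabilityMeasure P] (hI : MeasurableSet I) (hξ : ∀ n, Measurable (ξ n))
    (hindep : iIndepFun ξ P) (hident : ∀ n, IdentDistrib (ξ n) (ξ 0) P P)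
    (hξI : ∀ᵐ ω ∂P, ξ 0 ω ∈ I) {f : ℝ → ℝ} (hf : Measurable fun x : I => f x)
    (hmean : ∫ ω, f (ξ 0 ω) ∂P = 0) (hsq : Integrable (fun ω => f (ξ 0 ω) ^ 2) P)
    (hvar : 0 < ∫ ω, f (ξ 0 ω) ^ 2 ∂P) :
    ∀ᵐ ω ∂P,
      (∀ c, √(∫ ω, f (ξ 0 ω) ^ 2 ∂P) < c →
        ∀ᶠ n in atTop, (∑ i ∈ Finset.range n, f (ξ i ω)) / (n * lilRate n) ≤ c) ∧
      (∀ c, c < √(∫ ω, f (ξ 0 ω) ^ 2 ∂P) →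
        ∃ᶠ n in atTop, c ≤ (∑ i ∈ Finset.range n, f (ξ i ω)) / (n * lilRate n)) := by
  have hm := measurable_indicator_of_subtype hI hf
  have heq : (fun ω => I.indicator f (ξ 0 ω)) =ᵐ[P] fun ω => f (ξ 0 ω) := by
    filter_upwards [hξI] with ω hω
    exact indicator_of_mem hω f
  have heq2 : (fun ω => I.indicator f (ξ 0 ω) ^ 2) =ᵐ[P] fun ω => f (ξ 0 ω) ^ 2 := by
    filter_upwards [heq] with ω hω
    rw [hω]
  have hL2 : MemLp (fun ω => I.indicator f (ξ 0 ω)) 2 P :=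
    (memLp_two_iff_integrable_sq (hm.comp (hξ 0)).aestronglyMeasurable).2 (hsq.congr heq2.symm)
  have h := ae_lil (P := P) (X := fun i ω => I.indicator f (ξ i ω)) (fun i => hm.comp (hξ i))
    (hindep.comp (fun _ => I.indicator f) fun _ => hm) (fun i => (hident i).comp hm) hL2
    ((integral_congr_ae heq).trans hmean) (by rwa [integral_congr_ae heq2])
  rw [integral_congr_ae heq2] at h
  filter_upwards [h, ae_forall_mem hI hident hξI] with ω h1 h2
  have h3 : ∀ n, ∑ i ∈ Finset.range n, I.indicator f (ξ i ω) =
      ∑ i ∈ Finset.range n, f (ξ i ω) := fun n =>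
    Finset.sum_congr rfl fun i _ => indicator_of_mem (h2 i) f
  simpa only [h3] using h1

end Sampling

theorem abs_sum_expansion_le {t₀ t : ℝ} {H h : ℝ → ℝ} (ht : t ≠ t₀) {x : ℕ → ℝ}
    (hx : ∀ i, |(D (x i) t - D (x i) t₀) / (t - t₀) - partialSnd I D (x i) t₀| ≤
      H (x i) * h |t - t₀|) (n : ℕ) :
    |∑ i ∈ Finset.range n, D (x i) t - ∑ i ∈ Finset.range n, D (x i) t₀ -
      (t - t₀) * ∑ i ∈ Finset.range n, partialSnd I D (x i) t₀| ≤
      |t - t₀| * (h |t - t₀| * ∑ i ∈ Finset.range n, H (x i)) := by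
  have hne : t - t₀ ≠ 0 := sub_ne_zero.2 ht
  rw [Finset.mul_sum, Finset.mul_sum, Finset.mul_sum, ← Finset.sum_sub_distrib,
    ← Finset.sum_sub_distrib]
  refine (Finset.abs_sum_le_sum_abs _ _).trans (Finset.sum_le_sum fun i _ => ?_)
  have e : D (x i) t - D (x i) t₀ - (t - t₀) * partialSnd I D (x i) t₀ =
      (t - t₀) * ((D (x i) t - D (x i) t₀) / (t - t₀) - partialSnd I D (x i) t₀) := by
    field_simp
  rw [e, abs_mul, mul_comm (h |t - t₀|)]
  exact mul_le_mul_of_nonneg_left (hx i) (abs_nonneg _)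

theorem tendsto_increment_sum {t₀ r c m : ℝ} {H h : ℝ → ℝ} {x : ℕ → ℝ} (hr : 0 < r)
    (hrem : ∀ i, ∀ t ∈ Ioo (t₀ - r) (t₀ + r), t ≠ t₀ →
      |(D (x i) t - D (x i) t₀) / (t - t₀) - partialSnd I D (x i) t₀| ≤ H (x i) * h |t - t₀|)
    (hmean : Tendsto (fun n : ℕ => (∑ i ∈ Finset.range n, -partialSnd I D (x i) t₀) / n) atTop
      (𝓝 m))
    (hsmall : ∀ c, 0 < c → Tendsto (fun n : ℕ => h (c * lilRate n) *
      ((∑ i ∈ Finset.range n, H (x i)) / n)) atTop (𝓝 0)) :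
    Tendsto (fun n : ℕ => (∑ i ∈ Finset.range n, D (x i) (t₀ + c * lilRate n) -
      ∑ i ∈ Finset.range n, D (x i) t₀) / (n * lilRate n)) atTop (𝓝 (-(c * m))) := by
  -- The remainder bound excludes `t = t₀`, but then the increment vanishes.
  rcases eq_or_ne c 0 with rfl | hc
  · simp
  have hc' : 0 < |c| := abs_pos.2 hc
  have h1 : Tendsto (fun n : ℕ => (∑ i ∈ Finset.range n, D (x i) (t₀ + c * lilRate n) -
      ∑ i ∈ Finset.range n, D (x i) t₀) / (n * lilRate n) -
      -(c * ((∑ i ∈ Finset.range n, -partialSnd I D (x i) t₀) / n))) atTop (𝓝 0) := by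
    have h2 := (hsmall |c| hc').const_mul |c|
    rw [mul_zero] at h2
    refine squeeze_zero_norm' ?_ h2
    have hw : Tendsto (fun n => |c| * lilRate n) atTop (𝓝 0) := by
      simpa using tendsto_lilRate.const_mul |c|
    filter_upwards [eventually_lilRate_pos, eventually_gt_atTop 0, hw.eventually_lt_const hr]
      with n hn1 hn2 hn3
    have hn' : (0 : ℝ) < n := by exact_mod_cast hn2
    have habs : |t₀ + c * lilRate n - t₀| = |c| * lilRate n := by
      rw [add_sub_cancel_left, abs_mul, abs_of_pos hn1]
    have hmem : t₀ + c * lilRate n ∈ Ioo (t₀ - r) (t₀ + r) := by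
      have h4 := abs_lt.1 (habs.trans_lt hn3)
      exact ⟨by linarith [h4.1], by linarith [h4.2]⟩
    have hne : t₀ + c * lilRate n ≠ t₀ := by
      simpa using ⟨hc, hn1.ne'⟩
    have key := abs_sum_expansion_le hne (fun i => hrem i _ hmem hne) n
    rw [habs, add_sub_cancel_left] at key
    rw [Real.norm_eq_abs]
    have hnl : 0 < n * lilRate n := by positivity
    have e : (∑ i ∈ Finset.range n, D (x i) (t₀ + c * lilRate n) -
        ∑ i ∈ Finset.range n, D (x i) t₀) / (n * lilRate n) -
        -(c * ((∑ i ∈ Finset.range n, -partialSnd I D (x i) t₀) / n)) =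
        (∑ i ∈ Finset.range n, D (x i) (t₀ + c * lilRate n) -
          ∑ i ∈ Finset.range n, D (x i) t₀ -
          c * lilRate n * ∑ i ∈ Finset.range n, partialSnd I D (x i) t₀) / (n * lilRate n) := by
      rw [Finset.sum_neg_distrib]
      field_simp
    rw [e, abs_div, abs_of_pos hnl, div_le_iff₀ hnl]
    refine key.trans_eq ?_
    field_simp
  have h3 := h1.add (hmean.const_mul c).neg
  rw [zero_add] at h3
  refine h3.congr fun n => ?_
  ring

end Deviation

/-- Comparison of the normalised deviation mean with the normalised sums `∑ D (x i) t₀`. -/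
theorem IsDeviation.exists_comparison {I : Set ℝ} {D : ℝ → ℝ → ℝ} (hI : I.OrdConnected)
    (hD : IsDeviation I D) {t₀ r m : ℝ} {H h : ℝ → ℝ} {x : ℕ → ℝ} (hr : 0 < r)
    (hrI : Ioo (t₀ - r) (t₀ + r) ⊆ I) (hx : ∀ i, x i ∈ I)
    (hrem : ∀ i, ∀ t ∈ Ioo (t₀ - r) (t₀ + r), t ≠ t₀ →
      |(D (x i) t - D (x i) t₀) / (t - t₀) - partialSnd I D (x i) t₀| ≤ H (x i) * h |t - t₀|)
    (hmean : Tendsto (fun n : ℕ => (∑ i ∈ Finset.range n, -partialSnd I D (x i) t₀) / n) atTop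
      (𝓝 m))
    (hsmall : ∀ c, 0 < c → Tendsto (fun n : ℕ => h (c * lilRate n) *
      ((∑ i ∈ Finset.range n, H (x i)) / n)) atTop (𝓝 0)) (c : ℝ) :
    ∃ g : ℕ → ℝ, Tendsto g atTop (𝓝 (-(c * m))) ∧ ∀ᶠ n in atTop,
      ((∑ i ∈ Finset.range n, D (x i) t₀) / (n * lilRate n) + g n < 0 →
        (deviationMean I D n (fun i : Fin n => x i) - t₀) / lilRate n < c) ∧
      (0 < (∑ i ∈ Finset.range n, D (x i) t₀) / (n * lilRate n) + g n →
        c < (deviationMean I D n (fun i : Fin n => x i) - t₀) / lilRate n) := by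
  refine ⟨_, tendsto_increment_sum (c := c) hr hrem hmean hsmall, ?_⟩
  have hw : Tendsto (fun n => |c| * lilRate n) atTop (𝓝 0) := by
    simpa using tendsto_lilRate.const_mul |c|
  filter_upwards [eventually_lilRate_pos, eventually_gt_atTop 0, hw.eventually_lt_const hr]
    with n hn1 hn2 hn3
  have hn' : (0 : ℝ) < n := by exact_mod_cast hn2
  have hnl : 0 < n * lilRate n := by positivity
  have hmem : t₀ + c * lilRate n ∈ I := by
    have habs : |c * lilRate n| = |c| * lilRate n := by rw [abs_mul, abs_of_pos hn1]
    have h4 := abs_lt.1 (habs.trans_lt hn3)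
    exact hrI ⟨by linarith [h4.1], by linarith [h4.2]⟩
  -- Adding the increment turns the sum at `t₀` into the sum at `t₀ + c * lilRate n`, whose sign
  -- locates the mean.
  rw [← add_div, add_sub_cancel,
    ← Fin.sum_univ_eq_sum_range (fun i => D (x i) (t₀ + c * lilRate n)) n]
  refine ⟨fun h => ?_, fun h => ?_⟩
  · rw [div_lt_iff₀ hnl, zero_mul] at h
    have := hD.deviationMean_lt hI hn2 (fun i : Fin n => x i) (fun i => hx i) hmem h
    rw [div_lt_iff₀ hn1]
    linarith
  · rw [lt_div_iff₀ hnl, zero_mul] at h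
    have := hD.lt_deviationMean hI hn2 (fun i : Fin n => x i) (fun i => hx i) hmem h
    rw [lt_div_iff₀ hn1]
    linarith

theorem theorem5p1 {Ω : Type*} [MeasurableSpace Ω] (P : Measure Ω) [IsProbabilityMeasure P]
    (I : Set ℝ) (hI : I.OrdConnected) (hI' : I.Nontrivial)
    (D : ℝ → ℝ → ℝ) (hD : IsDeviation I D)
    -- an i.i.d. sequence `ξ₁, ξ₂, …`, written as `ξ 0, ξ 1, …`
    (ξ : ℕ → Ω → ℝ) (hξ : ∀ n, Measurable (ξ n)) (hindep : iIndepFun ξ P)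
    (hident : ∀ n, IdentDistrib (ξ n) (ξ 0) P P)
    -- Borel measurability of `D` in the first variable
    (hDmeas : IsBorelMeasurableFst I D)
    -- the deviation mean of `ξ₁` exists and is an interior point
    (hξI : ∀ᵐ ω ∂P, ξ 0 ω ∈ I)
    (t₀ : ℝ) (ht₀ : IsDeviationMeanOf P I D (ξ 0) t₀)
    (ht₀_int : t₀ ∈ interior (integrabilityDomain P I D (ξ 0)))
    -- the remainder of the first-order expansion of `D` at `t₀`
    (hrem : RemainderCondition P I D (ξ 0) t₀)
    -- positive finite moments
    (hD2 : Integrable (fun ω => D (ξ 0 ω) t₀ ^ 2) P)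
    (hD2_pos : 0 < ∫ ω, D (ξ 0 ω) t₀ ^ 2 ∂P)
    (hdD : Integrable (fun ω => -partialSnd I D (ξ 0 ω) t₀) P)
    (hdD_pos : 0 < ∫ ω, -partialSnd I D (ξ 0 ω) t₀ ∂P) :
    (∀ᵐ ω ∂P,
      limsup (fun n : ℕ =>
          (((deviationMean I D n (fun i : Fin n => ξ i ω) - t₀)
            / √(2 * (n : ℝ)⁻¹ * Real.log (Real.log n)) : ℝ) : EReal)) atTop
        = ((√(∫ ω', D (ξ 0 ω') t₀ ^ 2 ∂P)
            / ∫ ω', -partialSnd I D (ξ 0 ω') t₀ ∂P : ℝ) : EReal)) ∧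
    (∀ᵐ ω ∂P,
      liminf (fun n : ℕ =>
          (((deviationMean I D n (fun i : Fin n => ξ i ω) - t₀)
            / √(2 * (n : ℝ)⁻¹ * Real.log (Real.log n)) : ℝ) : EReal)) atTop
        = ((-(√(∫ ω', D (ξ 0 ω') t₀ ^ 2 ∂P)
            / ∫ ω', -partialSnd I D (ξ 0 ω') t₀ ∂P) : ℝ) : EReal)) := by

  have hIm : MeasurableSet I := hI.measurableSet
  obtain ⟨hdiff, r, α, q, H, h, hr, -, hαq, hH, hHm, hh, hrI, hrem', hlim0, hlim, hHq⟩ := hrem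
  have hrI' : Ioo (t₀ - r) (t₀ + r) ⊆ I := fun t ht => (hrI ht).1
  have hpm := measurable_partialSnd hr hrI' hDmeas hdiff
  have hDt := hDmeas t₀ ht₀.1.1
  have hmean := ae_tendsto_average hIm hindep hident hξI
    (f := fun x => -partialSnd I D x t₀) hpm.neg hdD
  have hHavg := ae_tendsto_average hIm hindep hident hξI
    (f := fun x => H x ^ q) (hHm.pow_const q) hHq
  have hlil := ae_lil_comp hIm hξ hindep hident hξI (f := fun x => D x t₀) hDt ht₀.2 hD2 hD2_pos
  have hlil_neg := ae_lil_comp hIm hξ hindep hident hξI (f := fun x => -D x t₀) hDt.neg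
    (by rw [integral_neg, ht₀.2, neg_zero]) (by simpa only [neg_sq] using hD2)
    (by simpa only [neg_sq] using hD2_pos)
  simp only [neg_sq, Finset.sum_neg_distrib, neg_div] at hlil_neg
  -- The comparison is deterministic once the two averages converge and all samples lie in `I`, so
  -- one null set serves every real `c`.
  have hcomp : ∀ᵐ ω ∂P, ∀ c, ∃ g : ℕ → ℝ,
      Tendsto g atTop (𝓝 (-(c * ∫ ω', -partialSnd I D (ξ 0 ω') t₀ ∂P))) ∧ ∀ᶠ n in atTop,
      ((∑ i ∈ Finset.range n, D (ξ i ω) t₀) / (n * lilRate n) + g n < 0 →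
        (deviationMean I D n (fun i : Fin n => ξ i ω) - t₀) / lilRate n < c) ∧
      (0 < (∑ i ∈ Finset.range n, D (ξ i ω) t₀) / (n * lilRate n) + g n →
        c < (deviationMean I D n (fun i : Fin n => ξ i ω) - t₀) / lilRate n) := by
    filter_upwards [hmean, hHavg, ae_forall_mem hIm hident hξI] with ω h1 h2 h3
    exact hD.exists_comparison hI hr hrI' h3 (fun i => hrem' _ (h3 i)) h1 fun c hc =>
      tendsto_modulus_mul_average hr hαq hh hlim0 hlim (fun i => hH _ (h3 i)) h2 hc
  constructor
  · filter_upwards [hlil, hcomp] with ω h1 h2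
    exact EReal.limsup_eq_of_comparison hdD_pos h1.1 h1.2 h2
  · filter_upwards [hlil_neg, hcomp] with ω h1 h2
    exact EReal.liminf_eq_of_comparison hdD_pos h1.1 h1.2 h2
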